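/- **Conventions.** Let $p$ be a prime, $\overline{\mathbb F_p}$ an algebraic closure of $\mathbb F_p$; all finite fields of characteristic $p$ are taken inside $\overline{\mathbb F_p}$. An affine variety $X\subset\overline{\mathbb F_p}^n$ is the common zero set of a set of polynomials. For a subfield $E$, $I(X,E)$ is the ideal of the polynomials in $E[x_1,\dots,x_n]$ vanishing on $X$, and $\dim X$ is the Krull dimension of $\overline{\mathbb F_p}[x_1,\dots,x_n]/I(X,\overline{\mathbb F_p})$. $X$ is defined over $\mathbb F_q$ (written $X/\mathbb F_q$) if $I(X,\overline{\mathbb F_p})$ is generated by some $f_1,\dots,f_m\in\mathbb F_q[x_1,\dots,x_n]$. For $a\in X\cap E^n$ put $$T_a(X,E)=\Big\{v\in E^n \ \Big|\ \sum_j v_j\tfrac{\partial f}{\partial x_j}(a)=0\ \text{ for all } f\in I(X,E)\Big\}.$$ For $X/\mathbb F_q$ and $a\in X$ let $\mathbb F_{q^{\delta(a)}}$ be the smallest extension of $\mathbb F_q$ over which $a$ is rational; the code $T_a(X,\mathbb F_{q^{\delta(a)}})$ is the finite Zariski tangent space (tangent code) to $X$ at $a$. $X$ is smooth if at each $a\in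 X$ the dimension of $T_a(X,\overline{\mathbb F_p})$ equals the dimension of the local ring of $X$ at $a$. A code $C\subset E^n$ is cyclic if $\zeta C=C$ for the shift $\zeta(x_1,\dots,x_n)=(x_2,\dots,x_n,x_1)$. Let $\mathcal D_{p,n}$ be the set of the monic divisors of $t^n-1$ in $\overline{\mathbb F_p}[t]$. For $g\in\mathcal D_{p,n}$ and a field $E$ containing its coefficients, $\langle\overline g\rangle_E\subset E^n$ is the code of those words $(c_0,\dots,c_{n-1})$ for which the class of $\sum_i c_it^i$ lies in the ideal of $E[t]/\langle t^n-1\rangle$ generated by the class of $g$. For $X/\mathbb F_q$, $a\in X$ and $g\in\mathcal D_{p,n}$, the tangent code at $a$ is said to be $\langle\overline g\rangle$ if $T_a(X,\mathbb F_{q^{\delta(a)}})$ and $\langle\overline g\rangle_{\mathbb F_{q^{\delta(g)}}}$ have the same extension to the common definition field over $\mathbb F_q$ of $a$ and the coefficients of $g$, where $\mathbb F_{q^{\delta(g)}}$ is the definition field over $\mathbb F_q$ of the coefficients of $g$. All cyclic codes of length $n$ and dimension $k$ over $\overline{\mathbb F_p}$ are realized as finite Zariski tangent spaces to $X$ if for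 each $g\in\mathcal D_{p,n}$ of degree $n-k$ there is $a\in X$ at which the tangent code is $\langle\overline g\rangle$. **Statement.** (i) Let $X/\mathbb F_q\subset\overline{\mathbb F_q}^n=\overline{\mathbb F_p}^n$ be an irreducible $k$-dimensional affine variety with $I(X,\overline{\mathbb F_q})=\langle f_1,\dots,f_m\rangle$, $f_i\in\mathbb F_q[x_1,\dots,x_n]$, let $$XT^\zeta=\{a\in X\mid \zeta T_a(X,\mathbb F_{q^{\delta(a)}})=T_a(X,\mathbb F_{q^{\delta(a)}})\}$$ and let $X^{\rm smooth}=\{a\in X\mid \operatorname{rk}\frac{\partial f}{\partial x}(a)=n-k\}$. Then $XT^\zeta\cap X^{\rm smooth}$ is a Zariski closed subset of $X^{\rm smooth}$. (ii) Let $n$ be a natural number with $\gcd(p,n)=1$. There are a finite field $\mathbb F_q$ and non-empty smooth affine varieties $X_g/\mathbb F_q\subset\overline{\mathbb F_p}^n$, $g\in\mathcal D_{p,n}$, such that for each $g$ the tangent code to $X_g$ at each of its points is cyclic and is $\langle\overline g\rangle$. (So all tangent codes of the abstract coproduct $\coprod_{g\in\mathcal D_{p,n}}X_g$ are cyclic,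 and it realizes all cyclic codes of length $n$ over $\overline{\mathbb F_p}$.) Moreover the $X_g$ with $g\neq1$ can be taken pairwise disjoint and such that $$X^\zeta_{p,n}=\coprod_{g\in\mathcal D_{p,n}\setminus\{1\}}X_g\subset\overline{\mathbb F_p}^n$$ is a smooth affine variety defined over $\mathbb F_q$, all finite Zariski tangent spaces to $X^\zeta_{p,n}$ are cyclic codes, and for every $0\le k<n$ all cyclic codes of length $n$ and dimension $k$ over $\overline{\mathbb F_p}$ are realized as finite Zariski tangent spaces to $X^\zeta_{p,n}$. (iii) For all integers $1\le k<n$ and $M\geq 0$ with $\gcd(p,n)=1$ there are a finite field $\mathbb F_q$ and an affine variety $X/\mathbb F_q\subset\overline{\mathbb F_p}^n$ with $\dim X=k$, such that all cyclic codes of length $n$ and dimension $k$ over $\overline{\mathbb F_p}$ are realized as finite Zariski tangent spaces to $X$, and at least $M$ codes, pairwise distinct also after extension to $\overline{\mathbb F_p}$, are non-cyclic finite Zariski tangent spaces to $X$. -/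

import Mathlib

open MvPolynomial

noncomputable section

namespace TangentCodes

/-! ### Linear codes over subfields -/

/-- The cyclic shift of components, `ζ (x₁, x₂, …, xₙ) = (x₂, …, xₙ, x₁)`. -/
def shift (n : ℕ) (E : Type*) [Field E] : (Fin n → E) →ₗ[E] (Fin n → E) :=
  LinearMap.funLeft E E (finRotate n)

/-- A linear code `C ⊆ Eⁿ` is cyclic if `ζ C = C`. -/
def IsCyclicCode {n : ℕ} {E : Type*} [Field E] (C : Submodule E (Fin n → E)) : Prop :=
  C.map (shift n E) = C

/-- The constant field extension `C ⊗_E L ⊆ Lⁿ` of a linear code `C ⊆ Eⁿ`: the `L`-linear span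
of the image of `C` under the componentwise embedding `φ : E → L`. -/
def extendCode {n : ℕ} {E L : Type*} [Field E] [Field L] (φ : E →+* L)
    (C : Submodule E (Fin n → E)) : Submodule L (Fin n → L) :=
  Submodule.span L ((fun v j => φ (v j)) '' (C : Set (Fin n → E)))

/-- The quotient ring `E[t] / ⟨tⁿ - 1⟩`. -/
abbrev CyclicRing (n : ℕ) (E : Type*) [Field E] : Type _ :=
  Polynomial E ⧸ (Ideal.span {Polynomial.X ^ n - 1} : Ideal (Polynomial E))

/-- The identification of words with residue classes,
`(c₀, …, cₙ₋₁) ↦ c₀ + c₁ t + ⋯ + cₙ₋₁ tⁿ⁻¹ mod (tⁿ - 1)`. -/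
def wordClass (n : ℕ) (E : Type*) [Field E] : (Fin n → E) →ₗ[E] CyclicRing n E :=
  (Ideal.Quotient.mkₐ E (Ideal.span {Polynomial.X ^ n - 1} : Ideal (Polynomial E))).toLinearMap ∘ₗ
    ∑ i : Fin n, (Polynomial.monomial (i : ℕ)) ∘ₗ (LinearMap.proj i)

/-- The code over `E` with generator polynomial `g`: the words whose class lies in the
principal ideal `⟨ḡ⟩` of `E[t] / ⟨tⁿ - 1⟩`. The polynomial `g` is given with coefficients in a
larger field `K`; it is used when its coefficients lie in `E`, and then the set of those `h` over
`E` that become `g` over `K` consists of `g` itself. -/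
def generatedCode (n : ℕ) (E : Type*) {K : Type*} [Field E] [Field K] [Algebra E K]
    (g : Polynomial K) : Submodule E (Fin n → E) :=
  Submodule.comap (wordClass n E)
    ((Ideal.span ((fun h : Polynomial E => (Ideal.Quotient.mk _ h : CyclicRing n E)) ''
      {h | h.map (algebraMap E K) = g})).restrictScalars E)

/-- The monic divisors of `tⁿ - 1` with coefficients in `K`. -/
def generators (n : ℕ) (K : Type*) [Field K] : Set (Polynomial K) :=
  {g | g.Monic ∧ g ∣ Polynomial.X ^ n - 1}

/-! ### Affine varieties -/

variable {K : Type*} [Field K] {n : ℕ}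

/-- `X ⊆ Kⁿ` is an affine variety (a Zariski closed subset): the common zero set of polynomials. -/
def IsAffineVariety (X : Set (Fin n → K)) : Prop :=
  ∃ I : Ideal (MvPolynomial (Fin n) K), X = zeroLocus K I

/-- `X` is non-empty and is not the union of two proper Zariski closed subsets. -/
def IsIrreducibleVariety (X : Set (Fin n → K)) : Prop :=
  X.Nonempty ∧ ∀ Z₁ Z₂ : Set (Fin n → K), IsAffineVariety Z₁ → IsAffineVariety Z₂ →
    X = Z₁ ∪ Z₂ → Z₁ = X ∨ Z₂ = X

/-- `f₁, …, fₘ ∈ F[x₁, …, xₙ]` generate the absolute ideal `I(X, K)`. -/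
def GenerateIdeal (F : Subfield K) (X : Set (Fin n → K)) {m : ℕ}
    (f : Fin m → MvPolynomial (Fin n) F) : Prop :=
  Ideal.span (Set.range fun i => MvPolynomial.map (algebraMap F K) (f i)) = vanishingIdeal K X

/-- `X` is defined over the subfield `F`: its absolute ideal is generated by finitely many
polynomials with coefficients in `F`. -/
def DefinedOver (F : Subfield K) (X : Set (Fin n → K)) : Prop :=
  ∃ (m : ℕ) (f : Fin m → MvPolynomial (Fin n) F), GenerateIdeal F X f

/-- The dimension of `X`: the Krull dimension of its affine coordinate ring. -/
def dimension (X : Set (Fin n → K)) : WithBot ℕ∞ :=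
  ringKrullDim (MvPolynomial (Fin n) K ⧸ vanishingIdeal K X)

/-- The dimension of `X` at its point `a`: the dimension of the local ring of `a`, that is the
height of the maximal ideal of `a` in the affine coordinate ring of `X`. -/
def localDimension (X : Set (Fin n → K)) (a : Fin n → K) : ℕ∞ :=
  ((vanishingIdeal K {a}).map (Ideal.Quotient.mk (vanishingIdeal K X))).height

/-- The Jacobian matrix `∂f/∂x (a)`, with entries in `K`. -/
def jacobian (F : Subfield K) {m : ℕ} (f : Fin m → MvPolynomial (Fin n) F) (a : Fin n → K) :
    Matrix (Fin m) (Fin n) K :=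
  Matrix.of fun i j => aeval a (pderiv j (f i))

/-! ### Zariski tangent spaces -/

/-- The Zariski tangent space `T_a(X, E) ⊆ Eⁿ` to `X` at an `E`-rational point `a ∈ X`, where
`E ⊆ K`: the vectors `v` with `∑ⱼ vⱼ ∂f/∂xⱼ (a) = 0` for all `f` in the ideal `I(X, E)` of the
polynomials over `E` that vanish on `X`. -/
def tangentSpace (E : Type*) [Field E] [Algebra E K] (X : Set (Fin n → K)) (a : Fin n → K) :
    Submodule E (Fin n → E) where
  carrier := {v | ∀ f ∈ (vanishingIdeal E X : Ideal (MvPolynomial (Fin n) E)),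
    ∑ j, algebraMap E K (v j) * aeval a (pderiv j f) = 0}
  zero_mem' := by
    intro f _
    simp
  add_mem' := by
    intro v w hv hw f hf
    simp only [Pi.add_apply, map_add, add_mul, Finset.sum_add_distrib, hv f hf, hw f hf, add_zero]
  smul_mem' := by
    intro c v hv f hf
    simp only [Pi.smul_apply, smul_eq_mul, map_mul, mul_assoc, ← Finset.mul_sum, hv f hf, mul_zero]

/-- `X` is smooth: at each of its points the dimension of the Zariski tangent space equals the
dimension of `X` at the point. -/
def IsSmoothVariety (X : Set (Fin n → K)) : Prop :=
  ∀ a ∈ X, (Module.finrank K (tangentSpace K X a) : ℕ∞) = localDimension X a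

/-- The common definition field over `F` of the elements of `S`: the smallest subfield of `K`
that contains `F` and `S`. -/
def definitionField (F : Subfield K) (S : Set K) : Subfield K :=
  Subfield.closure ((F : Set K) ∪ S)

theorem definitionField_mono (F : Subfield K) {S T : Set K} (h : S ⊆ T) :
    definitionField F S ≤ definitionField F T :=
  Subfield.closure_mono (Set.union_subset_union_right _ h)

/-- The definition field `F(a₁, …, aₙ)` of a point `a` over `F`. If `F` has `q` elements, it is
the field with `q ^ δ(a)` elements, `δ(a)` being minimal such that `a` is rational over it. -/
abbrev pointField (F : Subfield K) (a : Fin n → K) : Subfield K :=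
  definitionField F (Set.range a)

/-- The definition field over `F` of the coefficients of `g`. -/
abbrev coeffField (F : Subfield K) (g : Polynomial K) : Subfield K :=
  definitionField F (Set.range g.coeff)

/-- The common definition field over `F` of a point `a` and of the coefficients of `g`. -/
abbrev commonField (F : Subfield K) (a : Fin n → K) (g : Polynomial K) : Subfield K :=
  definitionField F (Set.range a ∪ Set.range g.coeff)

/-- For `X` defined over the finite field `F`: the finite Zariski tangent space to `X` at `a`,
a linear code over the definition field of `a`. -/
abbrev tangentCode (F : Subfield K) (X : Set (Fin n → K)) (a : Fin n → K) :
    Submodule (pointField F a) (Fin n → pointField F a) :=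
  tangentSpace (pointField F a) X a

/-- The tangent code to `X` at `a` and the cyclic code `⟨ḡ⟩` over the definition field of `g`
coincide after extension to the common definition field of `a` and `g`. -/
def TangentCodeIs (F : Subfield K) (X : Set (Fin n → K)) (a : Fin n → K) (g : Polynomial K) :
    Prop :=
  extendCode (Subfield.inclusion
      (definitionField_mono F (Set.subset_union_left : Set.range a ⊆ _)) :
      pointField F a →+* commonField F a g) (tangentCode F X a) =
    extendCode (Subfield.inclusion
      (definitionField_mono F (Set.subset_union_right : Set.range g.coeff ⊆ _)) :
      coeffField F g →+* commonField F a g) (generatedCode n (coeffField F g) g)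

/-- All cyclic codes of length `n` and dimension `k` over `K` are realized as finite Zariski
tangent spaces to `X`: each monic divisor `g` of `tⁿ - 1` of degree `n - k` is the generator
polynomial of the tangent code at some point of `X`. -/
def RealizesCyclicCodes (F : Subfield K) (X : Set (Fin n → K)) (k : ℕ) : Prop :=
  ∀ g ∈ generators n K, g.natDegree + k = n → ∃ a ∈ X, TangentCodeIs F X a g

/-- The points of `X` at which the finite Zariski tangent space is a cyclic code. -/
def cyclicLocus (F : Subfield K) (X : Set (Fin n → K)) : Set (Fin n → K) :=
  {a ∈ X | IsCyclicCode (tangentCode F X a)}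

/-- The smooth locus of an irreducible `k`-dimensional `X` with `I(X, K) = ⟨f₁, …, fₘ⟩`: the
points at which the Jacobian matrix has rank `n - k`. -/
def smoothLocus (F : Subfield K) (X : Set (Fin n → K)) {m : ℕ}
    (f : Fin m → MvPolynomial (Fin n) F) (k : ℕ) : Set (Fin n → K) :=
  {a ∈ X | (jacobian F f a).rank + k = n}

/-- The non-cyclic finite Zariski tangent spaces to `X`. They are collected as codes over `K`,
so that codes over different finite fields count once if they have the same extension to `K`. -/
def nonCyclicTangentCodes (F : Subfield K) (X : Set (Fin n → K)) :
    Set (Submodule K (Fin n → K)) :=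
  {C | ∃ a ∈ X, ¬ IsCyclicCode (tangentCode F X a) ∧
    C = extendCode (algebraMap (pointField F a) K) (tangentCode F X a)}

end TangentCodes

end

/-! All statements are reduced to codes over `K`. A tangent space to a variety defined over `F` at
an `E`-rational point, where `F ≤ E`, is cut out by a Jacobian matrix with entries in `E`; the code
`⟨ḡ⟩` is likewise cut out by linear equations over the coefficient field of `g`. Such a code is
spanned by its `E`-words, so cyclicity and equality may be tested after extension to `K`.

Part (i): with `J` the Jacobian at `a`, the code `ker J` is cyclic exactly when stacking `J` on `J ∘
ζ` does not raise the rank. On the smooth locus `J` has constant rank `n - k`, so the condition is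
the vanishing of the minors of size `n - k + 1` of the stack, and these are polynomials in `a`.

Parts (ii) and (iii) rest on one construction. Given a code `D` with parity checks `l₁, …, l_r`, `r
= n - dim D`, consider the equations `lᵢ(x) M(x)^p = lᵢ(w)`. In characteristic `p` the factor `M^p`
has zero derivative, so where `M ≠ 0` the gradients are non-zero multiples of the `lᵢ` and the
tangent space lies in `D`. Krull's height theorem bounds the local dimension below by `n - r = dim
D`, and the local dimension is at most that of the tangent space. Hence everything is equal: the
variety is smooth with constant tangent space `D` (`tangentSpace_eq_and_localDimension_eq`).

The freedom in `M` makes the pieces disjoint. If `D` is proper, a functional `φ` vanishing on `D`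
gives `φ(x) M(x)^p = const` on the piece; for a non-zero constant `M` has no zero there. Taking for
`M` a polynomial that vanishes on the pieces already built separates the new one from them
(`exists_isTwistedTranslate_avoiding`). The finite disjoint union is defined over a finite field
because finitely many elements algebraic over `𝔽_p` generate one. For (iii), explicit non-cyclic
codes of dimension `k` are added to the list of codes. -/

noncomputable section

namespace TangentCodes

/-! ### Codes defined by equations over a subfield -/

section Codes

variable {n : ℕ} {E L K : Type*} [Field E] [Field L] [Field K]

/-- The solutions over `L` of linear equations over `E` are spanned by solutions over `E`. -/
theorem mem_extendCode_of_forall (φ : E →+* L) (A : Set (Fin n → E))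
    (C : Submodule E (Fin n → E)) (hC : ∀ w, (∀ r ∈ A, ∑ j, w j * r j = 0) → w ∈ C)
    {v : Fin n → L} (hv : ∀ r ∈ A, ∑ j, v j * φ (r j) = 0) : v ∈ extendCode φ C := by
  classical
  let := φ.toAlgebra
  -- The coordinates of `v` are expanded in a basis of `L` over `E`. As the equations have
  -- coefficients in `E`, each vector of basis coefficients solves them separately.
  let b := Module.Basis.ofVectorSpace E L
  let s := Finset.univ.biUnion fun j => (b.repr (v j)).support
  have hv' : v = ∑ i ∈ s, b i • (fun j => φ (b.repr (v j) i)) := by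
    ext j
    rw [Finset.sum_apply]
    conv_lhs => rw [← b.linearCombination_repr (v j), Finsupp.linearCombination_apply,
      Finsupp.sum_of_support_subset (s := s) _
        (Finset.subset_biUnion_of_mem (fun j => (b.repr (v j)).support) (Finset.mem_univ j)) _
        (by simp)]
    refine Finset.sum_congr rfl fun i _ => ?_
    rw [Algebra.smul_def, Pi.smul_apply, smul_eq_mul, mul_comm]
    rfl
  rw [hv']
  refine sum_mem fun i _ => Submodule.smul_mem _ _ (Submodule.subset_span
    ⟨fun j => b.repr (v j) i, hC _ fun r hr => ?_, rfl⟩)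
  have h : ∑ j, r j • v j = 0 := by
    rw [← hv r hr]
    exact Finset.sum_congr rfl fun j _ => by rw [Algebra.smul_def, mul_comm]; rfl
  have h2 := congrArg (fun x => b.repr x i) h
  simpa [map_sum, Finsupp.finsetSum_apply, mul_comm] using h2

/-- The shift is injective, so a code that contains its own shift equals it by dimension. -/
theorem isCyclicCode_of_forall {C : Submodule E (Fin n → E)} (h : ∀ v ∈ C, shift n E v ∈ C) :
    IsCyclicCode C := by
  refine Submodule.eq_of_le_of_finrank_eq (Submodule.map_le_iff_le_comap.2 h) ?_
  exact (Submodule.equivMapOfInjective (shift n E)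
    (LinearMap.funLeft_injective_of_surjective _ _ _ (finRotate n).surjective) C).finrank_eq.symm

theorem IsCyclicCode.shift_mem {C : Submodule E (Fin n → E)} (h : IsCyclicCode C) {v : Fin n → E}
    (hv : v ∈ C) : shift n E v ∈ C := by
  rw [← (show C.map (shift n E) = C from h)]
  exact Submodule.mem_map_of_mem hv

theorem IsCyclicCode.extendCode {C : Submodule E (Fin n → E)} (h : IsCyclicCode C)
    (φ : E →+* L) : IsCyclicCode (extendCode φ C) := by
  refine isCyclicCode_of_forall fun v hv => ?_
  refine Submodule.span_induction (p := fun v _ => shift n L v ∈ TangentCodes.extendCode φ C)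
    ?_ ?_ ?_ ?_ hv
  · rintro _ ⟨v, hv, rfl⟩
    exact Submodule.subset_span ⟨shift n E v, h.shift_mem hv, rfl⟩
  · simp
  · intro x y _ _ hx hy
    rw [map_add]
    exact add_mem hx hy
  · intro c x _ hx
    rw [map_smul]
    exact Submodule.smul_mem _ _ hx

/-- The words over `E` of a code over `K`. -/
def restrictCode (E : Type*) [Field E] [Algebra E K] (D : Submodule K (Fin n → K)) :
    Submodule E (Fin n → E) where
  carrier := {v | (fun j => algebraMap E K (v j)) ∈ D}
  zero_mem' := by
    have : (fun _ : Fin n => (0 : K)) ∈ D := D.zero_mem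
    simpa using this
  add_mem' := by
    intro v w hv hw
    simpa using (show (fun j => algebraMap E K (v j) + algebraMap E K (w j)) ∈ D from
      D.add_mem hv hw)
  smul_mem' := by
    intro c v hv
    simpa using (show (fun j => algebraMap E K c * algebraMap E K (v j)) ∈ D from
      D.smul_mem (algebraMap E K c) hv)

theorem mem_restrictCode [Algebra E K] {D : Submodule K (Fin n → K)} {v : Fin n → E} :
    v ∈ restrictCode E D ↔ (fun j => algebraMap E K (v j)) ∈ D := Iff.rfl

/-- The code `D` over `K` is given by linear equations with coefficients in `E`. -/
def HasEquationsOver (E : Subfield K) (D : Submodule K (Fin n → K)) : Prop :=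
  ∃ A : Set (Fin n → E), ∀ v, v ∈ D ↔ ∀ r ∈ A, ∑ j, v j * algebraMap E K (r j) = 0

variable {D : Submodule K (Fin n → K)}

/-- This allows codes over different subfields to be compared over a common one, as restrictions of
codes over `K`. -/
theorem HasEquationsOver.extendCode_inclusion {E L : Subfield K} (hD : HasEquationsOver E D)
    (h : E ≤ L) : extendCode (Subfield.inclusion h) (restrictCode E D) = restrictCode L D := by
  obtain ⟨A, hA⟩ := hD
  apply le_antisymm
  · refine Submodule.span_le.2 ?_
    rintro _ ⟨v, hv, rfl⟩
    exact hv
  · intro v hv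
    refine mem_extendCode_of_forall _ A _ (fun w hw => ?_) (fun r hr => ?_)
    · refine (hA _).2 fun r hr => ?_
      have := congrArg (algebraMap E K) (hw r hr)
      simpa using this
    · have := (hA _).1 hv r hr
      apply L.subtype_injective
      simp only [map_sum, map_mul, map_zero]
      exact this

theorem HasEquationsOver.extendCode_algebraMap {E : Subfield K} (hD : HasEquationsOver E D) :
    extendCode (algebraMap E K) (restrictCode E D) = D := by
  obtain ⟨A, hA⟩ := hD
  apply le_antisymm
  · refine Submodule.span_le.2 ?_
    rintro _ ⟨v, hv, rfl⟩
    exact hv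
  · intro v hv
    refine mem_extendCode_of_forall _ A _ (fun w hw => ?_) (fun r hr => ?_)
    · refine (hA _).2 fun r hr => ?_
      have := congrArg (algebraMap E K) (hw r hr)
      simpa using this
    · exact (hA _).1 hv r hr

theorem HasEquationsOver.isCyclicCode_restrictCode_iff {E : Subfield K}
    (hD : HasEquationsOver E D) : IsCyclicCode (restrictCode E D) ↔ IsCyclicCode D := by
  refine ⟨fun h => ?_, fun h => isCyclicCode_of_forall fun v hv => ?_⟩
  · rw [← hD.extendCode_algebraMap]
    exact h.extendCode _
  · exact h.shift_mem hv

end Codes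

/-! ### Cyclic codes -/

section Generated

variable {n : ℕ} {E K : Type*} [Field E] [Field K]

/-- The polynomial `c₀ + c₁ t + ⋯ + cₙ₋₁ tⁿ⁻¹` of a word. -/
def wordPoly (n : ℕ) (E : Type*) [Field E] : (Fin n → E) →ₗ[E] Polynomial E :=
  ∑ i : Fin n, (Polynomial.monomial (i : ℕ)) ∘ₗ (LinearMap.proj i)

theorem wordPoly_apply (c : Fin n → E) :
    wordPoly n E c = ∑ i : Fin n, Polynomial.monomial (i : ℕ) (c i) := by
  simp [wordPoly]

theorem map_wordPoly (φ : E →+* K) (c : Fin n → E) :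
    (wordPoly n E c).map φ = wordPoly n K (fun j => φ (c j)) := by
  simp [wordPoly_apply, Polynomial.map_sum]

theorem mk_mem_span_mk_iff {g f h : Polynomial E} (hg : g ∣ f) :
    Ideal.Quotient.mk (Ideal.span {f}) h ∈
      Ideal.span {Ideal.Quotient.mk (Ideal.span {f}) g} ↔ g ∣ h := by
  have h1 := Ideal.map_span (Ideal.Quotient.mk (Ideal.span {f})) {g}
  rw [Set.image_singleton] at h1
  rw [← h1, Ideal.mem_quotient_iff_mem, Ideal.mem_span_singleton]
  rwa [Ideal.span_singleton_le_span_singleton]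

/-- Since `g` divides `tⁿ - 1`, membership in the ideal of the quotient ring is divisibility of
representatives, and divisibility does not change under field extension. -/
theorem mem_generatedCode_iff [Algebra E K] {g : Polynomial K} (hg : g ∈ generators n K)
    (hE : ∃ h : Polynomial E, h.map (algebraMap E K) = g) {c : Fin n → E} :
    c ∈ generatedCode n E g ↔ g ∣ wordPoly n K (fun j => algebraMap E K (c j)) := by
  obtain ⟨h, rfl⟩ := hE
  have hinj := Polynomial.map_injective _ (algebraMap E K).injective
  have hs : {h' : Polynomial E | h'.map (algebraMap E K) = h.map (algebraMap E K)} = {h} := by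
    ext h'
    exact hinj.eq_iff
  have hd : h ∣ Polynomial.X ^ n - 1 := by
    have := hg.2
    rw [← Polynomial.map_dvd_map' (algebraMap E K)]
    simpa using this
  rw [← map_wordPoly, Polynomial.map_dvd_map', ← mk_mem_span_mk_iff hd]
  unfold generatedCode
  rw [hs, Set.image_singleton]
  rfl

theorem generatedCode_eq_restrictCode [Algebra E K] {g : Polynomial K} (hg : g ∈ generators n K)
    (hE : ∃ h : Polynomial E, h.map (algebraMap E K) = g) :
    generatedCode n E g = restrictCode E (generatedCode n K g) := by
  ext c
  rw [mem_generatedCode_iff hg hE, mem_restrictCode, mem_generatedCode_iff hg ⟨g, by simp⟩]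
  rfl

theorem mem_generatedCode_self_iff {g : Polynomial K} (hg : g ∈ generators n K) {c : Fin n → K} :
    c ∈ generatedCode n K g ↔ g ∣ wordPoly n K c :=
  mem_generatedCode_iff hg ⟨g, by simp⟩

theorem hasEquationsOver_generatedCode {E : Subfield K} {g : Polynomial K}
    (hg : g ∈ generators n K) (hE : ∃ h : Polynomial E, h.map (algebraMap E K) = g) :
    HasEquationsOver E (generatedCode n K g) := by
  obtain ⟨h, rfl⟩ := hE
  have hm : h.Monic := Polynomial.monic_of_injective (algebraMap E K).injective hg.1
  -- The remainder of a word modulo `g` is linear in the word; its coefficients are the parity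
  -- checks, with entries read off from `t^j mod g`.
  refine ⟨Set.range fun i (j : Fin n) => ((Polynomial.X ^ (j : ℕ) : Polynomial E) %ₘ h).coeff i,
    fun v => ?_⟩
  rw [mem_generatedCode_self_iff hg, ← Polynomial.modByMonic_eq_zero_iff_dvd hg.1,
    Polynomial.ext_iff, Set.forall_mem_range]
  refine forall_congr' fun i => ?_
  have h1 : ∀ j : Fin n, Polynomial.monomial (j : ℕ) (v j) %ₘ h.map (algebraMap E K) =
      v j • ((Polynomial.X ^ (j : ℕ) : Polynomial E) %ₘ h).map (algebraMap E K) := by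
    intro j
    rw [Polynomial.map_modByMonic _ hm, ← Polynomial.smul_modByMonic, Polynomial.map_pow,
      Polynomial.map_X, Polynomial.smul_X_eq_monomial]
  have h2 : wordPoly n K v %ₘ h.map (algebraMap E K) = ∑ j : Fin n,
      v j • ((Polynomial.X ^ (j : ℕ) : Polynomial E) %ₘ h).map (algebraMap E K) := by
    rw [wordPoly_apply, ← Finset.sum_congr rfl fun j _ => h1 j]
    exact map_sum (Polynomial.modByMonicHom (h.map (algebraMap E K))) _ _
  rw [h2, Polynomial.finsetSum_coeff]
  simp [Polynomial.coeff_map]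

/-- The shift is division by `t` modulo `tⁿ - 1`, and `g`, as a divisor of `tⁿ - 1`, is coprime to
`t`. -/
theorem isCyclicCode_generatedCode {g : Polynomial K} (hg : g ∈ generators n K) :
    IsCyclicCode (generatedCode n K g) := by
  refine isCyclicCode_of_forall fun v hv => ?_
  rw [mem_generatedCode_self_iff hg] at hv ⊢
  obtain _ | n := n
  · rwa [Subsingleton.elim (shift 0 K v) v]
  have hX : IsCoprime g Polynomial.X := by
    refine IsCoprime.of_isCoprime_of_dvd_left
      (?_ : IsCoprime (Polynomial.X ^ (n + 1) - 1 : Polynomial K) _) hg.2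
    exact ⟨-1, Polynomial.X ^ n, by ring⟩
  refine hX.dvd_of_dvd_mul_left ?_
  have : Polynomial.X * wordPoly (n + 1) K (shift (n + 1) K v) =
      wordPoly (n + 1) K v + Polynomial.C (v 0) * (Polynomial.X ^ (n + 1) - 1) := by
    rw [wordPoly_apply, wordPoly_apply, Fin.sum_univ_castSucc, Fin.sum_univ_succ, mul_add,
      Finset.mul_sum]
    have h1 : ∀ i : Fin n, shift (n + 1) K v i.castSucc = v i.succ := by
      intro i
      simp [shift, LinearMap.funLeft_apply]
    have h2 : shift (n + 1) K v (Fin.last n) = v 0 := by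
      simp [shift, LinearMap.funLeft_apply]
    simp only [h1, h2, Polynomial.X_mul_monomial, Fin.val_castSucc, Fin.val_succ, Fin.val_last,
      Fin.val_zero]
    simp only [← Polynomial.C_mul_X_pow_eq_monomial]
    ring
  rw [this]
  exact dvd_add hv (hg.2.mul_left _)

theorem wordPoly_surjective_mod {g : Polynomial K} (hg : g ∈ generators n K) (hn : n ≠ 0) :
    Function.Surjective (((Ideal.span {g}).mkQ.restrictScalars K) ∘ₗ wordPoly n K) := by
  intro x
  obtain ⟨f, rfl⟩ := Submodule.Quotient.mk_surjective _ x
  have hdeg : (f %ₘ g).degree < n := by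
    refine (Polynomial.degree_modByMonic_lt f hg.1).trans_le ?_
    have h0 : (Polynomial.X ^ n - 1 : Polynomial K) ≠ 0 := by
      rw [← Polynomial.C_1]
      exact Polynomial.X_pow_sub_C_ne_zero (Nat.pos_of_ne_zero hn) 1
    refine (Polynomial.degree_le_of_dvd hg.2 h0).trans ?_
    rw [← Polynomial.C_1, Polynomial.degree_X_pow_sub_C (Nat.pos_of_ne_zero hn)]
  refine ⟨fun i => (f %ₘ g).coeff i, ?_⟩
  have : wordPoly n K (fun i => (f %ₘ g).coeff i) = f %ₘ g := by
    rw [wordPoly_apply, Fin.sum_univ_eq_sum_range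
      (fun i => Polynomial.monomial i ((f %ₘ g).coeff i)) n]
    refine (Polynomial.as_sum_range' _ n ?_).symm
    by_cases h : f %ₘ g = 0
    · rw [h, Polynomial.natDegree_zero]
      exact Nat.pos_of_ne_zero hn
    · exact (Polynomial.natDegree_lt_iff_degree_lt h).2 hdeg
  rw [LinearMap.comp_apply, this]
  refine (Submodule.Quotient.eq _).2 ?_
  rw [Ideal.mem_span_singleton]
  exact ⟨-(f /ₘ g), by linear_combination Polynomial.modByMonic_add_div f g⟩

/-- Rank-nullity for the map sending a word to its class modulo `g`, which is onto because
remainders have degree less than `n`. -/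
theorem finrank_generatedCode {g : Polynomial K} (hg : g ∈ generators n K) (hn : n ≠ 0) :
    Module.finrank K (generatedCode n K g) + g.natDegree = n := by
  set φ := ((Ideal.span {g}).mkQ.restrictScalars K) ∘ₗ wordPoly n K
  have hker : LinearMap.ker φ = generatedCode n K g := by
    ext c
    rw [mem_generatedCode_self_iff hg, ← Ideal.mem_span_singleton, LinearMap.mem_ker]
    exact Submodule.Quotient.mk_eq_zero _
  have h := φ.finrank_range_add_finrank_ker
  rw [LinearMap.range_eq_top.2 (wordPoly_surjective_mod hg hn), finrank_top, hker] at h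
  have h2 := finrank_quotient_span_eq_natDegree (f := g)
  simp only [Module.finrank_fin_fun] at h
  omega

theorem generatedCode_lt_top {g : Polynomial K} (hg : g ∈ generators n K) (hn : n ≠ 0)
    (h1 : g ≠ 1) : generatedCode n K g < ⊤ := by
  refine lt_top_iff_ne_top.2 fun h => h1 (hg.1.natDegree_eq_zero.1 ?_)
  have := finrank_generatedCode hg hn
  rw [h] at this
  simpa using this

theorem finite_generators (hn : n ≠ 0) : (generators n K).Finite := by
  have h0 : (Polynomial.X ^ n - 1 : Polynomial K) ≠ 0 := by
    rw [← Polynomial.C_1]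
    exact Polynomial.X_pow_sub_C_ne_zero (Nat.pos_of_ne_zero hn) 1
  exact @Set.toFinite _ (generators n K)
    (@Finite.of_fintype _ (Polynomial.fintypeSubtypeMonicDvd _ h0))

end Generated

/-! ### Heights of maximal ideals and tangent spaces -/

section Krull

variable {K : Type*} [Field K] {n : ℕ}

theorem mem_tangentSpace_self_iff {X : Set (Fin n → K)} {a v : Fin n → K} :
    v ∈ tangentSpace K X a ↔
      ∀ f ∈ vanishingIdeal K X, ∑ j, v j * aeval a (pderiv j f) = 0 := Iff.rfl

/-- The automorphism of the polynomial ring that translates the variables by `c`. -/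
def translate (c : Fin n → K) : MvPolynomial (Fin n) K ≃ₐ[K] MvPolynomial (Fin n) K :=
  AlgEquiv.ofAlgHom (aeval fun i => X i + C (c i)) (aeval fun i => X i - C (c i))
    (by ext; simp) (by ext; simp)

theorem aeval_translate (a c : Fin n → K) (f : MvPolynomial (Fin n) K) :
    aeval a (translate c f) = aeval (a + c) f := by
  have : (aeval a).comp (translate c).toAlgHom = aeval (a + c) := by
    ext i
    simp [translate]
  exact DFunLike.congr_fun this f

/-- By the Nullstellensatz all maximal ideals come from points, and translations permute the points
transitively. So all have the same height, which is then the Krull dimension `n`. -/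
theorem height_vanishingIdeal_singleton [IsAlgClosed K] (a : Fin n → K) :
    (vanishingIdeal K {a} : Ideal (MvPolynomial (Fin n) K)).height = n := by
  have hconst : ∀ b : Fin n → K, (vanishingIdeal K {b} : Ideal (MvPolynomial (Fin n) K)).height =
      (vanishingIdeal K {a} : Ideal (MvPolynomial (Fin n) K)).height := by
    intro b
    rw [← (translate (b - a)).toRingEquiv.height_comap (vanishingIdeal K {a})]
    congr 1
    ext f
    rw [Ideal.mem_comap, mem_vanishingIdeal_singleton_iff, mem_vanishingIdeal_singleton_iff]
    change _ ↔ aeval a (translate (b - a) f) = 0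
    rw [aeval_translate, add_sub_cancel]
  have h1 := Ideal.sup_isMaximal_height_eq_ringKrullDim (R := MvPolynomial (Fin n) K)
  have h2 : (⨆ (I : Ideal (MvPolynomial (Fin n) K)) (_ : I.IsMaximal), I.height) =
      (vanishingIdeal K {a} : Ideal (MvPolynomial (Fin n) K)).height := by
    apply le_antisymm
    · refine iSup₂_le fun I hI => ?_
      obtain ⟨b, rfl⟩ := isMaximal_iff_eq_vanishingIdeal_singleton.1 hI
      exact (hconst b).le
    · exact le_iSup₂_of_le (vanishingIdeal K {a}) inferInstance le_rfl
  rw [h2, MvPolynomial.ringKrullDim_of_isNoetherianRing, ringKrullDim_eq_zero_of_field,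
    zero_add, Nat.card_fin] at h1
  exact_mod_cast h1

/-- First order Taylor expansion. -/
theorem sub_taylor_mem_sq (a : Fin n → K) (f : MvPolynomial (Fin n) K) :
    f - C (aeval a f) - ∑ j, C (aeval a (pderiv j f)) * (X j - C (a j)) ∈
      (vanishingIdeal K {a} : Ideal (MvPolynomial (Fin n) K)) ^ 2 := by
  have hX : ∀ j, X j - C (a j) ∈ (vanishingIdeal K {a} : Ideal (MvPolynomial (Fin n) K)) := by
    intro j
    rw [mem_vanishingIdeal_singleton_iff]
    simp
  induction f using MvPolynomial.induction_on with
  | C c => simp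
  | add p q hp hq =>
    convert add_mem hp hq using 1
    simp only [map_add, add_mul, Finset.sum_add_distrib]
    ring
  | mul_X p i hp =>
    -- The remainder for `p * X i` is `X i` times the remainder for `p` plus a combination of the
    -- products `(X j - a j) * (X i - a i)`.
    have h1 := Ideal.mul_mem_right (X i) _ hp
    have h2 : ∑ j, C (aeval a (pderiv j p)) * ((X j - C (a j)) * (X i - C (a i))) ∈
        (vanishingIdeal K {a} : Ideal (MvPolynomial (Fin n) K)) ^ 2 := by
      refine sum_mem fun j _ => Ideal.mul_mem_left _ _ ?_
      rw [pow_two]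
      exact Ideal.mul_mem_mul (hX j) (hX i)
    convert add_mem h1 h2 using 1
    have h3 : ∀ j, C (aeval a (pderiv j (p * X i))) * (X j - C (a j)) =
        C (a i) * (C (aeval a (pderiv j p)) * (X j - C (a j))) +
          (if i = j then C (aeval a p) * (X i - C (a i)) else 0) := by
      intro j
      rw [Derivation.leibniz, pderiv_X]
      rcases eq_or_ne i j with rfl | h
      · simp
        ring
      · simp [h]
        ring
    have h4 : ∀ j, C (aeval a (pderiv j p)) * ((X j - C (a j)) * (X i - C (a i))) =
        X i * (C (aeval a (pderiv j p)) * (X j - C (a j))) -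
        C (a i) * (C (aeval a (pderiv j p)) * (X j - C (a j))) := fun j => by ring
    simp only [h3, h4, Finset.sum_add_distrib, Finset.sum_sub_distrib, ← Finset.mul_sum,
      Finset.sum_ite_eq, Finset.mem_univ, if_true, map_mul, aeval_X]
    ring

/-- The gradient at `a`, as a linear map. -/
def gradient (a : Fin n → K) : MvPolynomial (Fin n) K →ₗ[K] (Fin n → K) :=
  LinearMap.pi fun j => (aeval a).toLinearMap ∘ₗ (pderiv j).toLinearMap

theorem gradient_apply (a : Fin n → K) (f : MvPolynomial (Fin n) K) (j : Fin n) :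
    gradient a f j = aeval a (pderiv j f) := rfl

/-- A prime ideal inside the maximal ideal of `a` whose gradients at `a` span is that ideal. -/
theorem eq_vanishingIdeal_singleton_of_gradient (a : Fin n → K)
    (p : Ideal (MvPolynomial (Fin n) K)) [p.IsPrime] (hp : p ≤ vanishingIdeal K {a})
    (h : (p.restrictScalars K).map (gradient a) = ⊤) : p = vanishingIdeal K {a} := by
  set m : Ideal (MvPolynomial (Fin n) K) := vanishingIdeal K {a} with hm
  have hX : ∀ j, X j - C (a j) ∈ p ⊔ m ^ 2 := by
    intro j
    obtain ⟨g, hg, hgj⟩ := (Submodule.mem_map).1 (h ▸ Submodule.mem_top :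
      (Pi.single j 1 : Fin n → K) ∈ (p.restrictScalars K).map (gradient a))
    have h1 := sub_taylor_mem_sq a g
    have h2 : aeval a g = 0 := (mem_vanishingIdeal_singleton_iff a g).1 (hp hg)
    have h3 : ∑ i, C (aeval a (pderiv i g)) * (X i - C (a i)) =
        (X j - C (a j) : MvPolynomial (Fin n) K) := by
      simp only [← gradient_apply, hgj]
      rw [Finset.sum_eq_single j]
      · simp
      · intro i _ hij
        simp [hij]
      · simp
    rw [h2, h3, map_zero, sub_zero] at h1
    have := sub_mem (Ideal.mem_sup_left hg : g ∈ p ⊔ m ^ 2) (Ideal.mem_sup_right h1)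
    simpa using this
  have hle : m ≤ p ⊔ m ^ 2 := by
    intro f hf
    have h1 := Ideal.mem_sup_right (S := p) (sub_taylor_mem_sq a f)
    rw [(mem_vanishingIdeal_singleton_iff a f).1 hf, map_zero, sub_zero] at h1
    have h2 : ∑ j, C (aeval a (pderiv j f)) * (X j - C (a j)) ∈ p ⊔ m ^ 2 :=
      sum_mem fun j _ => Ideal.mul_mem_left _ _ (hX j)
    simpa using add_mem h1 h2
  -- From `m = p + m²` the image of `m` in the noetherian domain modulo `p` is idempotent, hence
  -- zero or the unit ideal; the latter is excluded by `p ≤ m`.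
  have hidem : IsIdempotentElem (m.map (Ideal.Quotient.mk p)) := by
    have h1 := Ideal.map_mono (f := Ideal.Quotient.mk p) hle
    rw [Ideal.map_sup, Ideal.map_quotient_self, bot_sup_eq, Ideal.map_pow, pow_two] at h1
    exact le_antisymm Ideal.mul_le_left h1
  rcases (Ideal.isIdempotentElem_iff_eq_bot_or_top _ (IsNoetherian.noetherian _)).1 hidem with
    h0 | h0
  · rw [Ideal.map_eq_bot_iff_le_ker, Ideal.mk_ker] at h0
    exact le_antisymm hp h0
  · have := Ideal.comap_map_mk hp
    rw [h0, Ideal.comap_top] at this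
    exact absurd this.symm (Ideal.IsPrime.ne_top inferInstance)

/-- Linear coordinates on the tangent space give as many affine linear functions `Λ i` vanishing at
`a`. Modulo `I(X)` the maximal ideal of `a` is minimal over them, so Krull's height theorem applies.
-/
theorem localDimension_le_finrank {X : Set (Fin n → K)} {a : Fin n → K} (ha : a ∈ X) :
    localDimension X a ≤ Module.finrank K (tangentSpace K X a) := by
  set T := tangentSpace K X a
  set I : Ideal (MvPolynomial (Fin n) K) := vanishingIdeal K X
  have hI : I ≤ vanishingIdeal K {a} :=
    vanishingIdeal_anti_mono (Set.singleton_subset_iff.2 ha)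
  obtain ⟨l, hl⟩ := T.subtype.exists_leftInverse_of_injective T.ker_subtype
  let b := Module.finBasis K T
  let Λ : Fin (Module.finrank K T) → MvPolynomial (Fin n) K := fun i =>
    ∑ j, C (b.repr (l (Pi.single j 1)) i) * (MvPolynomial.X j - C (a j))
  have hΛ : ∀ i, Λ i ∈ (vanishingIdeal K {a} : Ideal (MvPolynomial (Fin n) K)) := by
    intro i
    rw [mem_vanishingIdeal_singleton_iff]
    simp [Λ]
  have hgΛ : ∀ i j, gradient a (Λ i) j = b.repr (l (Pi.single j 1)) i := by
    intro i j
    simp [Λ, gradient_apply, Derivation.leibniz, pderiv_X, Pi.single_apply]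
  have key : ∀ p : Ideal (MvPolynomial (Fin n) K), p.IsPrime → I ≤ p → (∀ i, Λ i ∈ p) →
      p ≤ vanishingIdeal K {a} → p = vanishingIdeal K {a} := by
    intro p hp hIp hΛp hpm
    refine eq_vanishingIdeal_singleton_of_gradient a p hpm ?_
    by_contra hne
    -- A functional killing all gradients of `p` is pairing with a vector `v`. It is tangent because
    -- `I ≤ p`, and its coordinates in `T` vanish because `Λ i ∈ p`, so `v = 0`.
    obtain ⟨φ, hφ, hle⟩ := Submodule.exists_le_ker_of_lt_top _ (lt_top_iff_ne_top.2 hne)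
    have hφv : ∀ x, φ x = ∑ j, φ (Pi.single j 1) * x j := by
      intro x
      conv_lhs => rw [pi_eq_sum_univ' x]
      simp [mul_comm]
    set v : Fin n → K := fun j => φ (Pi.single j 1) with hv
    have hvT : v ∈ T := fun f hf => by
      have := hle (Submodule.mem_map_of_mem (hIp hf))
      rwa [LinearMap.mem_ker, hφv] at this
    have hlv : l v = 0 := by
      apply b.repr.injective
      ext i
      have := hle (Submodule.mem_map_of_mem (hΛp i))
      rw [LinearMap.mem_ker, hφv] at this
      conv_lhs => rw [pi_eq_sum_univ' v]
      simpa [hgΛ] using this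
    have h0 : (⟨v, hvT⟩ : T) = 0 := by
      rw [← hlv]
      exact (DFunLike.congr_fun hl ⟨v, hvT⟩).symm
    have hv0 : v = 0 := congrArg Subtype.val h0
    apply hφ
    ext j
    exact congrFun hv0 j
  have hprime : ((vanishingIdeal K {a}).map (Ideal.Quotient.mk I)).IsPrime :=
    Ideal.isPrime_map_quotientMk_of_isPrime hI
  have hmin : (vanishingIdeal K {a}).map (Ideal.Quotient.mk I) ∈
      (Ideal.span (Set.range fun i => Ideal.Quotient.mk I (Λ i))).minimalPrimes := by
    refine ⟨⟨hprime, ?_⟩, ?_⟩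
    · rw [Ideal.span_le]
      rintro _ ⟨i, rfl⟩
      exact Ideal.mem_map_of_mem _ (hΛ i)
    · rintro q ⟨hq, hqs⟩ hqm
      have h1 : q.comap (Ideal.Quotient.mk I) = vanishingIdeal K {a} := by
        refine key _ (Ideal.comap_isPrime _ _) ?_ ?_ ?_
        · intro f hf
          rw [Ideal.mem_comap, Ideal.Quotient.eq_zero_iff_mem.2 hf]
          exact q.zero_mem
        · exact fun i => hqs (Ideal.subset_span ⟨i, rfl⟩)
        · rw [← Ideal.comap_map_mk hI]
          exact Ideal.comap_mono hqm
      rw [← h1, Ideal.map_comap_of_surjective _ Ideal.Quotient.mk_surjective]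
  refine (Ideal.height_le_card_of_mem_minimalPrimes_span (Set.finite_range _) hmin).trans ?_
  rw [← Set.image_univ]
  have := Set.ncard_image_le (f := fun i => Ideal.Quotient.mk I (Λ i)) (Set.finite_univ)
  rw [Set.ncard_univ, Nat.card_fin] at this
  exact_mod_cast this

/-- Lifts of `localDimension X a` functions over which the point is minimal in `X`, together with
the `f i`, have the ideal of `a` as a minimal prime: a prime containing the `f i` contains `I(X)` by
`hX`. That ideal has height `n`. -/
theorem le_localDimension_add [IsAlgClosed K] {X : Set (Fin n → K)} {a : Fin n → K} (ha : a ∈ X)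
    {r : ℕ} (f : Fin r → MvPolynomial (Fin n) K) (hf : ∀ i, aeval a (f i) = 0)
    (hX : vanishingIdeal K X ≤ (Ideal.span (Set.range f)).radical) :
    (n : ℕ∞) ≤ localDimension X a + r := by
  classical
  set I : Ideal (MvPolynomial (Fin n) K) := vanishingIdeal K X
  have hI : I ≤ vanishingIdeal K {a} :=
    vanishingIdeal_anti_mono (Set.singleton_subset_iff.2 ha)
  have hprime : ((vanishingIdeal K {a}).map (Ideal.Quotient.mk I)).IsPrime :=
    Ideal.isPrime_map_quotientMk_of_isPrime hI
  obtain ⟨s, hs, hcard⟩ := Ideal.exists_finset_card_eq_height_of_isNoetherianRing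
    ((vanishingIdeal K {a}).map (Ideal.Quotient.mk I))
  let g := Function.surjInv (Ideal.Quotient.mk_surjective (I := I))
  have hg : ∀ x, Ideal.Quotient.mk I (g x) = x := Function.surjInv_eq _
  let t : Finset (MvPolynomial (Fin n) K) := s.image g ∪ Finset.univ.image f
  have ht : (vanishingIdeal K {a} : Ideal (MvPolynomial (Fin n) K)) ∈
      (Ideal.span (t : Set (MvPolynomial (Fin n) K))).minimalPrimes := by
    refine ⟨⟨inferInstance, ?_⟩, ?_⟩
    · rw [Ideal.span_le]
      intro y hy
      rcases Finset.mem_union.1 hy with hy | hy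
      · obtain ⟨x, hx, rfl⟩ := Finset.mem_image.1 hy
        have : Ideal.Quotient.mk I (g x) ∈ (vanishingIdeal K {a}).map (Ideal.Quotient.mk I) := by
          rw [hg]
          exact hs.1.2 (Ideal.subset_span hx)
        rw [← Ideal.mem_comap, Ideal.comap_map_mk hI] at this
        exact this
      · obtain ⟨i, _, rfl⟩ := Finset.mem_image.1 hy
        exact (mem_vanishingIdeal_singleton_iff a _).2 (hf i)
    · rintro q ⟨hq, hqt⟩ hqm
      have hfq : Ideal.span (Set.range f) ≤ q := by
        rw [Ideal.span_le]
        rintro _ ⟨i, rfl⟩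
        exact hqt (Ideal.subset_span (by simp [t]))
      have hIq : I ≤ q := hX.trans (hq.radical_le_iff.2 hfq)
      have h1 := hs.2 ⟨Ideal.isPrime_map_quotientMk_of_isPrime hIq, ?_⟩ (Ideal.map_mono hqm)
      · have h2 := Ideal.comap_mono (f := Ideal.Quotient.mk I) h1
        rwa [Ideal.comap_map_mk hI, Ideal.comap_map_mk hIq] at h2
      · rw [Ideal.span_le]
        intro x hx
        rw [← hg x]
        refine Ideal.mem_map_of_mem _ (hqt (Ideal.subset_span ?_))
        exact Finset.mem_union_left _ (Finset.mem_image_of_mem g hx)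
  have h1 := Ideal.height_le_card_of_mem_minimalPrimes_span_finset ht
  rw [height_vanishingIdeal_singleton] at h1
  have h2 : t.card ≤ s.card + r := by
    refine (Finset.card_union_le _ _).trans (add_le_add Finset.card_image_le ?_)
    exact Finset.card_image_le.trans (by simp)
  unfold localDimension
  rw [← hcard]
  exact h1.trans (by exact_mod_cast h2)

end Krull

/-! ### Affine varieties with a prescribed constant tangent space -/

section AffineVariety

variable {K : Type*} [Field K] {n : ℕ}

theorem isAffineVariety_iff {X : Set (Fin n → K)} : IsAffineVariety X ↔
    ∀ a ∉ X, ∃ f : MvPolynomial (Fin n) K, (∀ x ∈ X, aeval x f = 0) ∧ aeval a f ≠ 0 := by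
  constructor
  · rintro ⟨I, rfl⟩ a ha
    rw [mem_zeroLocus_iff] at ha
    push Not at ha
    obtain ⟨f, hf, hfa⟩ := ha
    exact ⟨f, fun x hx => hx f hf, hfa⟩
  · refine fun h => ⟨vanishingIdeal K X, ?_⟩
    refine Set.Subset.antisymm (zeroLocus_vanishingIdeal_le X) fun a ha => ?_
    by_contra haX
    obtain ⟨f, hf, hfa⟩ := h a haX
    exact hfa (ha f hf)

/-- A product of polynomials separating `a` from the single pieces. It gives closedness of finite
unions and the cutoff that isolates one piece near `a`. -/
theorem exists_forall_aeval_eq_zero_and_ne_zero {ι : Type*} (S : Finset ι)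
    {Y : ι → Set (Fin n → K)} (hY : ∀ i ∈ S, IsAffineVariety (Y i)) {a : Fin n → K}
    (ha : ∀ i ∈ S, a ∉ Y i) : ∃ f : MvPolynomial (Fin n) K,
      (∀ i ∈ S, ∀ x ∈ Y i, aeval x f = 0) ∧ aeval a f ≠ 0 := by
  have h : ∀ i, ∃ f : MvPolynomial (Fin n) K,
      i ∈ S → (∀ x ∈ Y i, aeval x f = 0) ∧ aeval a f ≠ 0 := by
    intro i
    by_cases hi : i ∈ S
    · obtain ⟨f, hf⟩ := isAffineVariety_iff.1 (hY i hi) a (ha i hi)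
      exact ⟨f, fun _ => hf⟩
    · exact ⟨0, fun h => absurd h hi⟩
  choose f hf using h
  refine ⟨∏ i ∈ S, f i, fun i hi x hx => ?_, ?_⟩
  · rw [map_prod]
    exact Finset.prod_eq_zero hi ((hf i hi).1 x hx)
  · rw [map_prod]
    exact Finset.prod_ne_zero_iff.2 fun i hi => (hf i hi).2

theorem isAffineVariety_biUnion {ι : Type*} (S : Finset ι) {Y : ι → Set (Fin n → K)}
    (hY : ∀ i ∈ S, IsAffineVariety (Y i)) : IsAffineVariety (⋃ i ∈ S, Y i) := by
  refine isAffineVariety_iff.2 fun a ha => ?_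
  obtain ⟨f, hf, hfa⟩ := exists_forall_aeval_eq_zero_and_ne_zero S hY
    (a := a) (fun i hi h => ha (Set.mem_biUnion hi h))
  refine ⟨f, fun x hx => ?_, hfa⟩
  obtain ⟨i, hi, hx⟩ := Set.mem_iUnion₂.1 hx
  exact hf i hi x hx

end AffineVariety

/-! ### Twisted translates of a linear code and their disjoint unions. -/

section TwistedTranslate

variable {K : Type*} [Field K] {n : ℕ}

theorem exists_parityCheck (D : Submodule K (Fin n → K)) :
    ∃ (r : ℕ) (l : (Fin n → K) →ₗ[K] (Fin r → K)),
      LinearMap.ker l = D ∧ Module.finrank K D + r = n := by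
  refine ⟨Module.finrank K ((Fin n → K) ⧸ D),
    (Module.finBasis K ((Fin n → K) ⧸ D)).equivFun.toLinearMap ∘ₗ D.mkQ, ?_, ?_⟩
  · rw [LinearEquiv.ker_comp, Submodule.ker_mkQ]
  · have := D.finrank_quotient_add_finrank
    rw [Module.finrank_fin_fun] at this
    omega

theorem linearMap_apply_eq_sum {r : ℕ} (l : (Fin n → K) →ₗ[K] (Fin r → K)) (x : Fin n → K)
    (i : Fin r) : l x i = ∑ j, x j * l (Pi.single j 1) i := by
  conv_lhs => rw [pi_eq_sum_univ' x]
  simp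

/-- The points `x` with `M(x) ^ p • x ∈ w + D`. In characteristic `p` its tangent space at each
point with `M(x) ≠ 0` is `D`. -/
def twistedTranslate (p : ℕ) (D : Submodule K (Fin n → K)) (M : MvPolynomial (Fin n) K)
    (w : Fin n → K) : Set (Fin n → K) :=
  {x | (aeval x M) ^ p • x - w ∈ D}

/-- The equations of a twisted translate. -/
def twistedEquation (p : ℕ) {r : ℕ} (l : (Fin n → K) →ₗ[K] (Fin r → K))
    (M : MvPolynomial (Fin n) K) (w : Fin n → K) (i : Fin r) : MvPolynomial (Fin n) K :=
  (∑ j, C (l (Pi.single j 1) i) * X j) * M ^ p - C (l w i)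

theorem aeval_twistedEquation (p : ℕ) {r : ℕ} (l : (Fin n → K) →ₗ[K] (Fin r → K))
    (M : MvPolynomial (Fin n) K) (w x : Fin n → K) (i : Fin r) :
    aeval x (twistedEquation p l M w i) = l ((aeval x M) ^ p • x - w) i := by
  rw [map_sub, map_smul, Pi.sub_apply, Pi.smul_apply, linearMap_apply_eq_sum l x]
  simp [twistedEquation, mul_comm]

theorem pderiv_twistedEquation (p : ℕ) [CharP K p] {r : ℕ}
    (l : (Fin n → K) →ₗ[K] (Fin r → K)) (M : MvPolynomial (Fin n) K) (w : Fin n → K)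
    (i : Fin r) (j : Fin n) :
    pderiv j (twistedEquation p l M w i) = C (l (Pi.single j 1) i) * M ^ p := by
  have hp : pderiv j (M ^ p) = 0 := by
    rw [Derivation.leibniz_pow, ← Nat.cast_smul_eq_nsmul K, CharP.cast_eq_zero, zero_smul]
  simp [twistedEquation, Derivation.leibniz, hp, pderiv_X, Pi.single_apply, mul_comm]

theorem twistedTranslate_eq_zeroLocus (p : ℕ) {r : ℕ} (l : (Fin n → K) →ₗ[K] (Fin r → K))
    (M : MvPolynomial (Fin n) K) (w : Fin n → K) :
    twistedTranslate p (LinearMap.ker l) M w =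
      zeroLocus K (Ideal.span (Set.range (twistedEquation p l M w))) := by
  rw [zeroLocus_span]
  ext x
  simp only [twistedTranslate, Set.mem_ofPred_eq, LinearMap.mem_ker, Set.forall_mem_range,
    aeval_twistedEquation]
  exact funext_iff

theorem isAffineVariety_twistedTranslate (p : ℕ) (D : Submodule K (Fin n → K))
    (M : MvPolynomial (Fin n) K) (w : Fin n → K) : IsAffineVariety (twistedTranslate p D M w) := by
  obtain ⟨r, l, rfl, -⟩ := exists_parityCheck D
  exact ⟨_, twistedTranslate_eq_zeroLocus p l M w⟩

/-- A variety that is a twisted translate near `a` has the expected tangent space and dimension. -/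
theorem tangentSpace_eq_and_localDimension_eq [IsAlgClosed K] (p : ℕ) [CharP K p]
    {D : Submodule K (Fin n → K)} {M u : MvPolynomial (Fin n) K} {w a : Fin n → K}
    {Z : Set (Fin n → K)} (hZ : twistedTranslate p D M w ⊆ Z)
    (ha : a ∈ twistedTranslate p D M w) (hM : aeval a M ≠ 0) (hu : aeval a u ≠ 0)
    (huZ : ∀ x ∈ Z, x ∉ twistedTranslate p D M w → aeval x u = 0) :
    tangentSpace K Z a = D ∧ localDimension Z a = Module.finrank K D := by
  obtain ⟨r, l, rfl, hr⟩ := exists_parityCheck D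
  have haeq : ∀ i, aeval a (twistedEquation p l M w i) = 0 := by
    intro i
    rw [aeval_twistedEquation, (LinearMap.mem_ker).1 ha]
    rfl
  have hT : tangentSpace K Z a ≤ LinearMap.ker l := by
    intro v hv
    rw [LinearMap.mem_ker]
    ext i
    -- The cutoff `u` kills the rest of `Z`; at `a` the Leibniz rule only rescales the gradient by
    -- `u(a) ≠ 0`, since the equation itself vanishes there.
    have hmem : u * twistedEquation p l M w i ∈ vanishingIdeal K Z := by
      intro x hx
      by_cases hxt : x ∈ twistedTranslate p (LinearMap.ker l) M w
      · rw [map_mul, aeval_twistedEquation, (LinearMap.mem_ker).1 hxt, Pi.zero_apply, mul_zero]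
      · rw [map_mul, huZ x hx hxt, zero_mul]
    have h := mem_tangentSpace_self_iff.1 hv _ hmem
    have h1 : ∀ j, v j * aeval a (pderiv j (u * twistedEquation p l M w i)) =
        (aeval a u * (aeval a M) ^ p) * (v j * l (Pi.single j 1) i) := by
      intro j
      rw [Derivation.leibniz, pderiv_twistedEquation]
      simp only [smul_eq_mul, map_add, map_mul, haeq, map_pow, aeval_C, Algebra.algebraMap_self,
        RingHom.id_apply]
      ring
    rw [Finset.sum_congr rfl fun j _ => h1 j, ← Finset.mul_sum,
      ← linearMap_apply_eq_sum] at h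
    exact (mul_eq_zero.1 h).resolve_left (mul_ne_zero hu (pow_ne_zero _ hM))
  -- The chain `n - r ≤ localDimension ≤ dim T ≤ dim D = n - r` closes up. The ideal of `Z` is never
  -- computed: its inclusion in the radical of the ideal of the equations is enough.
  have h1 := le_localDimension_add (hZ ha) (twistedEquation p l M w) haeq (by
    rw [← vanishingIdeal_zeroLocus_eq_radical (K := K), ← twistedTranslate_eq_zeroLocus]
    exact vanishingIdeal_anti_mono hZ)
  have h2 := localDimension_le_finrank (hZ ha)
  have h3 := Submodule.finrank_mono hT
  obtain ⟨d, hd⟩ := ENat.ne_top_iff_exists.1 (h2.trans_lt (ENat.natCast_lt_top _)).ne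
  rw [← hd] at h1 h2 ⊢
  have h1' : n ≤ d + r := by exact_mod_cast h1
  have h2' : d ≤ Module.finrank K (tangentSpace K Z a) := by exact_mod_cast h2
  refine ⟨Submodule.eq_of_le_of_finrank_eq hT (by omega), ?_⟩
  have : d = Module.finrank K (LinearMap.ker l) := by omega
  rw [this]

/-- A non-empty twisted translate of `D` on which the twisting polynomial has no zero. -/
def IsTwistedTranslate (p : ℕ) (D : Submodule K (Fin n → K)) (Y : Set (Fin n → K)) : Prop :=
  ∃ M w, Y = twistedTranslate p D M w ∧ Y.Nonempty ∧ ∀ x ∈ Y, aeval x M ≠ 0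

theorem isTwistedTranslate_univ (p : ℕ) (D : Submodule K (Fin n → K)) (hD : D = ⊤) :
    IsTwistedTranslate p D Set.univ := by
  refine ⟨1, 0, ?_, ⟨0, trivial⟩, fun x _ => by simp⟩
  subst hD
  simp [twistedTranslate]

theorem IsTwistedTranslate.isAffineVariety {p : ℕ} {D : Submodule K (Fin n → K)}
    {Y : Set (Fin n → K)} (h : IsTwistedTranslate p D Y) : IsAffineVariety Y := by
  obtain ⟨M, w, rfl, -⟩ := h
  exact isAffineVariety_twistedTranslate p D M w

theorem IsTwistedTranslate.tangentSpace_eq_and_localDimension_eq [IsAlgClosed K] {p : ℕ}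
    [CharP K p] {D : Submodule K (Fin n → K)} {Y : Set (Fin n → K)}
    (h : IsTwistedTranslate p D Y) {a : Fin n → K} (ha : a ∈ Y) :
    tangentSpace K Y a = D ∧ localDimension Y a = Module.finrank K D := by
  obtain ⟨M, w, rfl, -, hM⟩ := h
  exact TangentCodes.tangentSpace_eq_and_localDimension_eq p (u := 1) subset_rfl ha (hM a ha)
    (by simp) fun x hx hx' => absurd hx hx'

/-- Twisted translates of a proper subspace avoid any given proper closed subset. -/
theorem exists_isTwistedTranslate_avoiding [Infinite K] {p : ℕ} (hp : p ≠ 0)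
    {D : Submodule K (Fin n → K)} (hD : D < ⊤) {P : MvPolynomial (Fin n) K} (hP : P ≠ 0) :
    ∃ Y, IsTwistedTranslate p D Y ∧ (∀ x ∈ Y, aeval x P ≠ 0) ∧
      ∃ Q : MvPolynomial (Fin n) K, Q ≠ 0 ∧ ∀ x ∈ Y, aeval x Q = 0 := by
  obtain ⟨φ, hφ, hle⟩ := Submodule.exists_le_ker_of_lt_top _ hD
  have hφs : ∀ x, φ x = ∑ j, φ (Pi.single j 1) * x j := by
    intro x
    conv_lhs => rw [pi_eq_sum_univ' x]
    simp [mul_comm]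
  let l : MvPolynomial (Fin n) K := ∑ j, C (φ (Pi.single j 1)) * X j
  have hl : ∀ x, aeval x l = φ x := by
    intro x
    rw [hφs]
    simp [l]
  have hl0 : l ≠ 0 := by
    intro h
    apply hφ
    refine LinearMap.ext fun x => ?_
    rw [← hl, h, map_zero, LinearMap.zero_apply]
  -- The piece is twisted by `P` itself and made to pass through `a` by `w = P(a)^p • a`. Applying
  -- `φ` shows that `P^p * φ` is constant on it, with value `P(a)^p * φ(a) ≠ 0`.
  obtain ⟨a, ha⟩ : ∃ a : Fin n → K, aeval a (P * l) ≠ 0 := by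
    by_contra! h
    refine mul_ne_zero hP hl0 (MvPolynomial.funext fun x => ?_)
    rw [map_zero, ← MvPolynomial.aeval_eq_eval]
    exact h x
  rw [map_mul, hl] at ha
  have hPa := left_ne_zero_of_mul ha
  have hφa := right_ne_zero_of_mul ha
  have hmem : ∀ x, x ∈ twistedTranslate p D P ((aeval a P) ^ p • a) →
      (aeval x P) ^ p * φ x = (aeval a P) ^ p * φ a := by
    intro x hx
    have := hle hx
    rwa [LinearMap.mem_ker, map_sub, map_smul, map_smul, sub_eq_zero] at this
  have hne : ∀ x ∈ twistedTranslate p D P ((aeval a P) ^ p • a), aeval x P ≠ 0 := by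
    intro x hx h0
    have := hmem x hx
    rw [h0, zero_pow hp, zero_mul] at this
    exact mul_ne_zero (pow_ne_zero _ hPa) hφa this.symm
  refine ⟨twistedTranslate p D P ((aeval a P) ^ p • a), ⟨P, _, rfl, ⟨a, ?_⟩, hne⟩, hne,
    P ^ p * l - C ((aeval a P) ^ p * φ a), ?_, ?_⟩
  · simp [twistedTranslate]
  · intro h0
    -- At the origin `l` vanishes and only the non-zero constant remains.
    have := congrArg (aeval (0 : Fin n → K)) h0
    rw [map_sub, map_mul, hl, map_zero, mul_zero, map_zero, zero_sub, neg_eq_zero, aeval_C] at this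
    exact mul_ne_zero (pow_ne_zero _ hPa) hφa this
  · intro x hx
    rw [map_sub, map_mul, map_pow, hl, aeval_C, hmem x hx]
    exact sub_self _

/-- The induction carries a non-zero polynomial `P` vanishing on the pieces so far; the next piece
avoids the zeros of `P`. -/
theorem exists_pairwiseDisjoint_isTwistedTranslate [Infinite K] {p : ℕ} (hp : p ≠ 0)
    {ι : Type*} (S : Finset ι) (D : ι → Submodule K (Fin n → K)) (hD : ∀ i ∈ S, D i < ⊤) :
    ∃ Y : ι → Set (Fin n → K), (∀ i ∈ S, IsTwistedTranslate p (D i) (Y i)) ∧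
      (S : Set ι).PairwiseDisjoint Y ∧
      ∃ P : MvPolynomial (Fin n) K, P ≠ 0 ∧ ∀ i ∈ S, ∀ x ∈ Y i, aeval x P = 0 := by
  classical
  induction S using Finset.induction_on with
  | empty => exact ⟨fun _ => ∅, by simp, by simp, 1, one_ne_zero, by simp⟩
  | insert i S hi ih =>
    obtain ⟨Y, hY, hdisj, P, hP, hPY⟩ := ih fun j hj => hD j (Finset.mem_insert_of_mem hj)
    obtain ⟨Z, hZ, hPZ, Q, hQ, hQZ⟩ :=
      exists_isTwistedTranslate_avoiding hp (hD i (Finset.mem_insert_self i S)) hP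
    have hup : ∀ j ∈ S, Function.update Y i Z j = Y j := fun j hj =>
      Function.update_of_ne (ne_of_mem_of_not_mem hj hi) _ _
    refine ⟨Function.update Y i Z, ?_, ?_, P * Q, mul_ne_zero hP hQ, ?_⟩
    · refine Finset.forall_mem_insert _ _ _ |>.2 ⟨by simpa using hZ, fun j hj => ?_⟩
      rw [hup j hj]
      exact hY j hj
    · rw [Finset.coe_insert]
      refine Set.PairwiseDisjoint.insert_of_notMem ?_ hi ?_
      · intro j hj k hk hjk
        rw [Function.onFun, hup j hj, hup k hk]
        exact hdisj hj hk hjk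
      · intro j hj
        rw [hup j hj, Function.update_self]
        exact Set.disjoint_left.2 fun x hx hxj => hPZ x hx (hPY j hj x hxj)
    · refine Finset.forall_mem_insert _ _ _ |>.2 ⟨fun x hx => ?_, fun j hj x hx => ?_⟩
      · rw [Function.update_self] at hx
        rw [map_mul, hQZ x hx, mul_zero]
      · rw [hup j hj] at hx
        rw [map_mul, hPY j hj x hx, zero_mul]

theorem tangentSpace_biUnion [IsAlgClosed K] {p : ℕ} [CharP K p] {ι : Type*} (S : Finset ι)
    (D : ι → Submodule K (Fin n → K)) {Y : ι → Set (Fin n → K)}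
    (hY : ∀ i ∈ S, IsTwistedTranslate p (D i) (Y i)) (hdisj : (S : Set ι).PairwiseDisjoint Y)
    {i : ι} (hi : i ∈ S) {a : Fin n → K} (ha : a ∈ Y i) :
    tangentSpace K (⋃ i ∈ S, Y i) a = D i ∧
      localDimension (⋃ i ∈ S, Y i) a = Module.finrank K (D i) := by
  classical
  obtain ⟨u, hu, hua⟩ := exists_forall_aeval_eq_zero_and_ne_zero (S.erase i) (Y := Y) (a := a)
    (fun j hj => (hY j (Finset.mem_of_mem_erase hj)).isAffineVariety)
    (fun j hj haj => Set.disjoint_left.1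
      (hdisj hi (Finset.mem_of_mem_erase hj) (Finset.ne_of_mem_erase hj).symm) ha haj)
  obtain ⟨M, w, hYi, -, hM⟩ := hY i hi
  refine tangentSpace_eq_and_localDimension_eq p (u := u) (hYi ▸ Set.subset_biUnion_of_mem hi)
    (hYi ▸ ha) (hM a ha) hua fun x hx hxi => ?_
  obtain ⟨j, hj, hxj⟩ := Set.mem_iUnion₂.1 hx
  rcases eq_or_ne j i with rfl | hji
  · exact absurd (hYi ▸ hxj) hxi
  · exact hu j (Finset.mem_erase.2 ⟨hji, hj⟩) x hxj

end TwistedTranslate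

/-! ### Fields of definition -/

section Definition

variable {K : Type*} [Field K] {n : ℕ}

theorem le_definitionField (F : Subfield K) (S : Set K) : F ≤ definitionField F S :=
  fun _ hx => Subfield.subset_closure (Or.inl hx)

theorem subset_definitionField (F : Subfield K) (S : Set K) :
    S ⊆ (definitionField F S : Set K) :=
  fun _ hx => Subfield.subset_closure (Or.inr hx)

/-- By the Leibniz rule at a point of `X`, where elements of the ideal vanish, the gradient of a
multiple is a multiple of the gradient. So generators suffice. -/
theorem GenerateIdeal.mem_tangentSpace_iff {F : Subfield K} {X : Set (Fin n → K)} {m : ℕ}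
    {f : Fin m → MvPolynomial (Fin n) F} (hf : GenerateIdeal F X f) {a : Fin n → K} (ha : a ∈ X)
    {v : Fin n → K} :
    v ∈ tangentSpace K X a ↔ ∀ i, ∑ j, v j * jacobian F f a i j = 0 := by
  have hmem : ∀ i, map (algebraMap F K) (f i) ∈ vanishingIdeal K X := fun i =>
    hf ▸ Ideal.subset_span ⟨i, rfl⟩
  have hjac : ∀ i j, jacobian F f a i j = aeval a (pderiv j (map (algebraMap F K) (f i))) := by
    intro i j
    rw [pderiv_map, aeval_map_algebraMap]
    rfl
  simp only [hjac]
  refine ⟨fun hv i => hv _ (hmem i), fun hv g hg => ?_⟩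
  rw [← hf] at hg
  refine Submodule.span_induction
    (p := fun g _ => ∑ j, v j * aeval a (pderiv j g) = 0) ?_ ?_ ?_ ?_ hg
  · rintro _ ⟨i, rfl⟩
    exact hv i
  · simp
  · intro x y _ _ hx hy
    simp only [map_add, mul_add, Finset.sum_add_distrib, hx, hy, add_zero]
  · intro c x hx h
    have hx0 : aeval a x = 0 := by
      have : x ∈ vanishingIdeal K X := by
        rw [← hf]
        exact hx
      exact this a ha
    have : ∀ j, v j * aeval a (pderiv j (c • x)) =
        aeval a c * (v j * aeval a (pderiv j x)) := by
      intro j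
      rw [smul_eq_mul, Derivation.leibniz, map_add, smul_eq_mul, smul_eq_mul, map_mul, map_mul,
        hx0]
      ring
    rw [Finset.sum_congr rfl fun j _ => this j, ← Finset.mul_sum, h, mul_zero]

/-- The generators over `F` lie in `I(X, E)`, which in turn lies in `I(X, K)`, so both ideals impose
the same conditions on a vector over `E`. -/
theorem tangentSpace_eq_restrictCode {F E : Subfield K} {X : Set (Fin n → K)}
    (hX : DefinedOver F X) (hFE : F ≤ E) {a : Fin n → K} (ha : a ∈ X) :
    tangentSpace E X a = restrictCode E (tangentSpace K X a) := by
  obtain ⟨m, f, hf⟩ := hX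
  have hE : ∀ (g : MvPolynomial (Fin n) F) (x : Fin n → K),
      aeval x (map (Subfield.inclusion hFE) g) = aeval x g := by
    intro g x
    rw [aeval_def, aeval_def, eval₂_map]
    rfl
  ext v
  rw [mem_restrictCode, hf.mem_tangentSpace_iff ha]
  constructor
  · intro hv i
    have := hv (map (Subfield.inclusion hFE) (f i)) fun x hx => by
      have hmem : map (algebraMap F K) (f i) ∈ vanishingIdeal K X :=
        hf ▸ Ideal.subset_span ⟨i, rfl⟩
      rw [hE, ← aeval_map_algebraMap K]
      exact hmem x hx
    simp only [pderiv_map, hE] at this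
    exact this
  · intro hv g hg
    have hg' : map (algebraMap E K) g ∈ vanishingIdeal K X := by
      intro x hx
      rw [aeval_map_algebraMap]
      exact hg x hx
    have := mem_tangentSpace_self_iff.1 ((hf.mem_tangentSpace_iff ha).2 hv) _ hg'
    simpa only [pderiv_map, aeval_map_algebraMap] using this

theorem hasEquationsOver_tangentSpace {F E : Subfield K} {X : Set (Fin n → K)}
    (hX : DefinedOver F X) (hFE : F ≤ E) {a : Fin n → K} (ha : a ∈ X) (haE : ∀ j, a j ∈ E) :
    HasEquationsOver E (tangentSpace K X a) := by
  obtain ⟨m, f, hf⟩ := hX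
  refine ⟨Set.range fun i j => aeval (fun j => (⟨a j, haE j⟩ : E))
    (map (Subfield.inclusion hFE) (pderiv j (f i))), fun v => ?_⟩
  rw [hf.mem_tangentSpace_iff ha, Set.forall_mem_range]
  have h : ∀ i j, algebraMap E K (aeval (fun j => (⟨a j, haE j⟩ : E))
      (map (Subfield.inclusion hFE) (pderiv j (f i)))) = jacobian F f a i j := by
    intro i j
    rw [← aeval_algebraMap_apply, aeval_def, eval₂_map]
    rfl
  simp only [h]

theorem hasEquationsOver_pointField {F : Subfield K} {X : Set (Fin n → K)}
    (hX : DefinedOver F X) {a : Fin n → K} (ha : a ∈ X) :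
    HasEquationsOver (pointField F a) (tangentSpace K X a) :=
  hasEquationsOver_tangentSpace hX (le_definitionField F _) ha
    fun j => subset_definitionField F _ ⟨j, rfl⟩

theorem tangentCode_eq_restrictCode {F : Subfield K} {X : Set (Fin n → K)}
    (hX : DefinedOver F X) {a : Fin n → K} (ha : a ∈ X) :
    tangentCode F X a = restrictCode (pointField F a) (tangentSpace K X a) :=
  tangentSpace_eq_restrictCode hX (le_definitionField F _) ha

theorem isCyclicCode_tangentCode_iff {F : Subfield K} {X : Set (Fin n → K)}
    (hX : DefinedOver F X) {a : Fin n → K} (ha : a ∈ X) :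
    IsCyclicCode (tangentCode F X a) ↔ IsCyclicCode (tangentSpace K X a) := by
  rw [tangentCode_eq_restrictCode hX ha]
  exact (hasEquationsOver_pointField hX ha).isCyclicCode_restrictCode_iff

theorem extendCode_tangentCode {F : Subfield K} {X : Set (Fin n → K)}
    (hX : DefinedOver F X) {a : Fin n → K} (ha : a ∈ X) :
    extendCode (algebraMap (pointField F a) K) (tangentCode F X a) = tangentSpace K X a := by
  rw [tangentCode_eq_restrictCode hX ha]
  exact (hasEquationsOver_pointField hX ha).extendCode_algebraMap

theorem tangentCodeIs_of_eq {F : Subfield K} {X : Set (Fin n → K)} (hX : DefinedOver F X)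
    {a : Fin n → K} (ha : a ∈ X) {g : Polynomial K} (hg : g ∈ generators n K)
    (h : tangentSpace K X a = generatedCode n K g) : TangentCodeIs F X a g := by
  have hE : ∃ g' : Polynomial (coeffField F g), g'.map (algebraMap _ K) = g := by
    rw [← Polynomial.mem_lifts, Polynomial.lifts_iff_coeff_lifts]
    intro k
    exact ⟨⟨g.coeff k, subset_definitionField F _ ⟨k, rfl⟩⟩, rfl⟩
  unfold TangentCodeIs
  rw [tangentCode_eq_restrictCode hX ha, generatedCode_eq_restrictCode hg hE,
    (hasEquationsOver_pointField hX ha).extendCode_inclusion,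
    (hasEquationsOver_generatedCode hg hE).extendCode_inclusion, h]

/-- Every variety is defined over all subfields that contain some finite set. -/
theorem exists_finite_forall_definedOver (X : Set (Fin n → K)) :
    ∃ s : Set K, s.Finite ∧ ∀ F : Subfield K, s ⊆ F → DefinedOver F X := by
  classical
  obtain ⟨t, ht⟩ := (IsNoetherian.noetherian (vanishingIdeal K X : Ideal (MvPolynomial (Fin n) K)))
  refine ⟨⋃ f ∈ t, (f.coeffs : Set K), t.finite_toSet.biUnion fun f _ => f.coeffs.finite_toSet,
    fun F hF => ?_⟩
  have h : ∀ f : t, ∃ f' : MvPolynomial (Fin n) F, map (algebraMap F K) f' = f := by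
    rintro ⟨f, hf⟩
    have : f ∈ Set.range (map (algebraMap F K)) := by
      rw [mem_range_map_iff_coeffs_subset]
      intro c hc
      exact ⟨⟨c, hF (Set.mem_biUnion hf hc)⟩, rfl⟩
    exact this
  choose f' hf' using h
  refine ⟨t.card, fun i => f' (t.equivFin.symm i), ?_⟩
  unfold GenerateIdeal
  rw [← ht]
  congr 1
  ext x
  simp only [hf', Set.mem_range]
  constructor
  · rintro ⟨i, rfl⟩
    exact (t.equivFin.symm i).2
  · exact fun hx => ⟨t.equivFin ⟨x, hx⟩, by simp⟩

theorem exists_finite_subfield (p : ℕ) [Fact p.Prime] [Algebra (ZMod p) K]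
    [Algebra.IsAlgebraic (ZMod p) K] {s : Set K} (hs : s.Finite) :
    ∃ F : Subfield K, Finite F ∧ s ⊆ F := by
  have : Finite s := hs
  have := IntermediateField.finiteDimensional_adjoin (K := ZMod p) (S := s)
    fun x _ => (Algebra.IsAlgebraic.isAlgebraic (R := ZMod p) x).isIntegral
  exact ⟨(IntermediateField.adjoin (ZMod p) s).toSubfield,
    Module.finite_of_finite (ZMod p) (M := IntermediateField.adjoin (ZMod p) s),
    IntermediateField.subset_adjoin (ZMod p) s⟩

/-- The maximal ideals of the coordinate ring are those of the points of `X`, so the Krull dimension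
is the supremum of the local dimensions. -/
theorem dimension_eq [IsAlgClosed K] {X : Set (Fin n → K)} (hX : IsAffineVariety X)
    (hne : X.Nonempty) {k : ℕ} (h : ∀ a ∈ X, localDimension X a = k) :
    dimension X = (k : WithBot ℕ∞) := by
  obtain ⟨a, ha⟩ := hne
  set I : Ideal (MvPolynomial (Fin n) K) := vanishingIdeal K X
  have hle : ∀ b ∈ X, I ≤ vanishingIdeal K {b} := fun b hb =>
    vanishingIdeal_anti_mono (Set.singleton_subset_iff.2 hb)
  have hnt : Nontrivial (MvPolynomial (Fin n) K ⧸ I) := by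
    refine Ideal.Quotient.nontrivial_iff.2 fun h => ?_
    have := hle a ha
    rw [h, top_le_iff] at this
    exact Ideal.IsPrime.ne_top inferInstance this
  unfold dimension
  rw [← Ideal.sup_isMaximal_height_eq_ringKrullDim]
  have : (⨆ (J : Ideal (MvPolynomial (Fin n) K ⧸ I)) (_ : J.IsMaximal), J.height) = (k : ℕ∞) := by
    apply le_antisymm
    · refine iSup₂_le fun J hJ => ?_
      have hmax : (J.comap (Ideal.Quotient.mk I)).IsMaximal :=
        Ideal.comap_isMaximal_of_surjective _ Ideal.Quotient.mk_surjective
      obtain ⟨b, hb⟩ := isMaximal_iff_eq_vanishingIdeal_singleton.1 hmax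
      have hIb : I ≤ vanishingIdeal K {b} := by
        rw [← hb]
        intro f hf
        rw [Ideal.mem_comap, Ideal.Quotient.eq_zero_iff_mem.2 hf]
        exact J.zero_mem
      have hbX : b ∈ X := by
        by_contra hbX
        obtain ⟨f, hf, hfb⟩ := isAffineVariety_iff.1 hX b hbX
        exact hfb ((mem_vanishingIdeal_singleton_iff b f).1 (hIb hf))
      rw [← h b hbX, localDimension, ← hb,
        Ideal.map_comap_of_surjective _ Ideal.Quotient.mk_surjective]
    · rw [← h a ha]
      refine le_iSup₂_of_le ((vanishingIdeal K {a}).map (Ideal.Quotient.mk I)) ?_ le_rfl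
      refine Ideal.IsMaximal.map_of_surjective_of_ker_le Ideal.Quotient.mk_surjective ?_
      rw [Ideal.mk_ker]
      exact hle a ha
  rw [this]
  rfl

end Definition

/-! ### The locus of the points with cyclic tangent codes -/

section Minors

variable {K : Type*} [Field K] {m n : Type*}

theorem exists_linearIndependent_row [Finite m] [Fintype n] (A : Matrix m n K) {s : ℕ}
    (h : s ≤ A.rank) : ∃ e : Fin s → m, LinearIndependent K (A.submatrix e id).row := by
  obtain ⟨κ, e, he, hspan, hli⟩ := exists_linearIndependent' K A.row
  have : Finite κ := Finite.of_injective e he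
  have := Fintype.ofFinite κ
  rw [A.rank_eq_finrank_span_row, ← hspan, finrank_span_eq_card hli] at h
  obtain ⟨i⟩ : Nonempty (Fin s ↪ κ) :=
    Function.Embedding.nonempty_of_card_le (by rwa [Fintype.card_fin])
  exact ⟨e ∘ i, hli.comp i i.injective⟩

theorem rank_le_iff_forall_det_submatrix_eq_zero [Finite m] [Fintype n] (A : Matrix m n K)
    {r : ℕ} : A.rank ≤ r ↔
      ∀ (s : Fin (r + 1) → m) (t : Fin (r + 1) → n), (A.submatrix s t).det = 0 := by
  constructor
  · intro h s t
    by_contra hdet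
    have h1 := Matrix.rank_of_det_ne_zero hdet
    have h2 := Matrix.rank_submatrix_le A s t
    rw [h1, Fintype.card_fin] at h2
    omega
  · intro h
    by_contra! hr
    -- Independent rows are selected first, then independent columns among these rows; the resulting
    -- minor is non-zero.
    obtain ⟨s, hs⟩ := exists_linearIndependent_row A (s := r + 1) hr
    have h1 : (A.submatrix s id).transpose.rank = r + 1 := by
      rw [Matrix.rank_transpose, hs.rank_matrix, Fintype.card_fin]
    obtain ⟨t, ht⟩ := exists_linearIndependent_row _ h1.ge
    have h2 := (Matrix.linearIndependent_rows_iff_isUnit.1 ht)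
    rw [Matrix.isUnit_iff_isUnit_det] at h2
    apply h2.ne_zero
    rw [← Matrix.det_transpose]
    exact h s t

end Minors

/-! ### Cyclicity of a kernel as a rank condition. -/

section CyclicLocus

variable {K : Type*} [Field K] {n m : ℕ}

/-- The matrix `J` stacked on the matrix of `J ∘ ζ`. -/
def shiftStack {R : Type*} (J : Matrix (Fin m) (Fin n) R) : Matrix (Fin m ⊕ Fin m) (Fin n) R :=
  Matrix.fromRows J (J.submatrix id (finRotate n).symm)

theorem mulVec_shift (J : Matrix (Fin m) (Fin n) K) (v : Fin n → K) :
    (J.submatrix id (finRotate n).symm).mulVec v = J.mulVec (shift n K v) := by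
  ext i
  simp only [Matrix.mulVec, dotProduct, Matrix.submatrix_apply, id]
  refine (Equiv.sum_comp (finRotate n) _).symm.trans (Finset.sum_congr rfl fun j _ => ?_)
  rw [Equiv.symm_apply_apply]
  rfl

/-- The kernel of the stack consists of the words of `ker J` whose shift is again in `ker J`. It is
all of `ker J` exactly when the ranks agree. -/
theorem isCyclicCode_ker_iff (J : Matrix (Fin m) (Fin n) K) :
    IsCyclicCode (LinearMap.ker J.mulVecLin) ↔ (shiftStack J).rank ≤ J.rank := by
  have hker : ∀ v, v ∈ LinearMap.ker (shiftStack J).mulVecLin ↔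
      v ∈ LinearMap.ker J.mulVecLin ∧ shift n K v ∈ LinearMap.ker J.mulVecLin := by
    intro v
    simp only [LinearMap.mem_ker, Matrix.mulVecLin_apply, shiftStack, Matrix.fromRows_mulVec,
      mulVec_shift]
    constructor
    · exact fun h => ⟨funext fun i => congrFun h (Sum.inl i),
        funext fun i => congrFun h (Sum.inr i)⟩
    · rintro ⟨h1, h2⟩
      rw [h1, h2]
      ext (i | i) <;> rfl
  have hle : LinearMap.ker (shiftStack J).mulVecLin ≤ LinearMap.ker J.mulVecLin :=
    fun v hv => ((hker v).1 hv).1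
  have h1 := J.mulVecLin.finrank_range_add_finrank_ker
  have h2 := (shiftStack J).mulVecLin.finrank_range_add_finrank_ker
  constructor
  · intro h
    have : LinearMap.ker J.mulVecLin ≤ LinearMap.ker (shiftStack J).mulVecLin :=
      fun v hv => (hker v).2 ⟨hv, h.shift_mem hv⟩
    have := Submodule.finrank_mono this
    simp only [Matrix.rank]
    omega
  · intro h
    simp only [Matrix.rank] at h
    have heq := Submodule.eq_of_le_of_finrank_le hle (by omega)
    refine isCyclicCode_of_forall fun v hv => ?_
    rw [← heq] at hv
    exact ((hker v).1 hv).2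

theorem GenerateIdeal.tangentSpace_eq_ker {F : Subfield K} {X : Set (Fin n → K)}
    {f : Fin m → MvPolynomial (Fin n) F} (hf : GenerateIdeal F X f) {a : Fin n → K} (ha : a ∈ X) :
    tangentSpace K X a = LinearMap.ker (jacobian F f a).mulVecLin := by
  ext v
  rw [hf.mem_tangentSpace_iff ha, LinearMap.mem_ker, Matrix.mulVecLin_apply, funext_iff]
  simp only [Matrix.mulVec, dotProduct, mul_comm, Pi.zero_apply]

theorem exists_cyclicLocus_inter_smoothLocus_eq {F : Subfield K} {X : Set (Fin n → K)}
    (hX : IsAffineVariety X) {f : Fin m → MvPolynomial (Fin n) F} (hf : GenerateIdeal F X f)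
    (k : ℕ) : ∃ Z : Set (Fin n → K), IsAffineVariety Z ∧ Z ⊆ X ∧
      cyclicLocus F X ∩ smoothLocus F X f k = Z ∩ smoothLocus F X f k := by
  refine ⟨{a ∈ X | (shiftStack (jacobian F f a)).rank ≤ n - k}, ?_, fun a ha => ha.1, ?_⟩
  · refine isAffineVariety_iff.2 fun a ha => ?_
    by_cases haX : a ∈ X
    · have h1 : ¬ (shiftStack (jacobian F f a)).rank ≤ n - k := fun h => ha ⟨haX, h⟩
      rw [rank_le_iff_forall_det_submatrix_eq_zero] at h1
      push Not at h1
      obtain ⟨s, t, hst⟩ := h1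
      -- The stack is formed over the polynomial ring, so that its minors are polynomials
      -- specializing to the minors at each point.
      let Q := shiftStack (Matrix.of fun i j => map (algebraMap F K) (pderiv j (f i)))
      have hQ : ∀ x, aeval x (Q.submatrix s t).det =
          ((shiftStack (jacobian F f x)).submatrix s t).det := by
        intro x
        rw [AlgHom.map_det]
        congr 1
        ext i j
        rcases h : s i with i' | i' <;>
          simp only [Q, shiftStack, AlgHom.mapMatrix_apply, Matrix.map_apply,
            Matrix.submatrix_apply, h,
            Matrix.fromRows_apply_inl, Matrix.fromRows_apply_inr, Matrix.of_apply, jacobian,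
            aeval_map_algebraMap]
      refine ⟨(Q.submatrix s t).det, fun x hx => ?_, (hQ a).trans_ne hst⟩
      rw [hQ]
      exact rank_le_iff_forall_det_submatrix_eq_zero _ |>.1 hx.2 s t
    · obtain ⟨g, hg, hga⟩ := isAffineVariety_iff.1 hX a haX
      exact ⟨g, fun x hx => hg x hx.1, hga⟩
  · ext a
    refine and_congr_left fun ha => ?_
    refine and_congr_right fun haX => ?_
    rw [isCyclicCode_tangentCode_iff ⟨m, f, hf⟩ haX, hf.tangentSpace_eq_ker haX,
      isCyclicCode_ker_iff]
    have : (jacobian F f a).rank = n - k := by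
      have := ha.2
      omega
    rw [this]

end CyclicLocus

/-! ### Non-cyclic codes -/

section NonCyclic

variable {K : Type*} [Field K] {n k : ℕ}

/-- The parametrization of the code `{v | v k = c * v 0, v j = 0 for j > k}`. -/
def wedgeMap (n : ℕ) (hk : 1 ≤ k) (c : K) : (Fin k → K) →ₗ[K] (Fin n → K) :=
  LinearMap.pi fun j => if h : (j : ℕ) < k then LinearMap.proj ⟨j, h⟩ else
    if (j : ℕ) = k then c • LinearMap.proj ⟨0, hk⟩ else 0

theorem wedgeMap_apply_of_lt (hk : 1 ≤ k) (c : K) (u : Fin k → K) {j : Fin n} (h : (j : ℕ) < k) :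
    wedgeMap n hk c u j = u ⟨j, h⟩ := by
  simp [wedgeMap, h]

theorem wedgeMap_apply_of_eq (hk : 1 ≤ k) (c : K) (u : Fin k → K) {j : Fin n} (h : (j : ℕ) = k) :
    wedgeMap n hk c u j = c * u ⟨0, hk⟩ := by
  simp [wedgeMap, h]

theorem wedgeMap_apply_of_gt (hk : 1 ≤ k) (c : K) (u : Fin k → K) {j : Fin n} (h : k < (j : ℕ)) :
    wedgeMap n hk c u j = 0 := by
  simp [wedgeMap, h.not_gt, h.ne']

theorem finrank_range_wedgeMap (hk : 1 ≤ k) (hkn : k < n) (c : K) :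
    Module.finrank K (LinearMap.range (wedgeMap n hk c)) = k := by
  rw [LinearMap.finrank_range_of_inj, Module.finrank_fin_fun]
  intro u v h
  ext j
  have := congrFun h ⟨j, j.2.trans hkn⟩
  rwa [wedgeMap_apply_of_lt hk c u (j := (⟨j, j.2.trans hkn⟩ : Fin n)) j.2,
    wedgeMap_apply_of_lt hk c v (j := (⟨j, j.2.trans hkn⟩ : Fin n)) j.2] at this

theorem apply_eq_of_mem_range_wedgeMap (hk : 1 ≤ k) (hkn : k < n) (c : K) {v : Fin n → K}
    (hv : v ∈ LinearMap.range (wedgeMap n hk c)) :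
    v ⟨k, hkn⟩ = c * v ⟨0, by omega⟩ := by
  obtain ⟨u, rfl⟩ := hv
  rw [wedgeMap_apply_of_eq hk c u rfl, wedgeMap_apply_of_lt hk c u (j := ⟨0, _⟩) hk]

/-- The word `(1, 0, …, 0, c, 0, …, 0)` with `c` in position `k`. -/
def wedgeWord (n : ℕ) (hk : 1 ≤ k) (c : K) : Fin n → K :=
  wedgeMap n hk c (Pi.single ⟨0, hk⟩ 1)

theorem wedgeWord_zero (hk : 1 ≤ k) (c : K) {j : Fin n} (h : (j : ℕ) = 0) :
    wedgeWord n hk c j = 1 := by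
  rw [wedgeWord, wedgeMap_apply_of_lt hk c _ (by omega)]
  simp [h]

theorem wedgeWord_self (hk : 1 ≤ k) (c : K) {j : Fin n} (h : (j : ℕ) = k) :
    wedgeWord n hk c j = c := by
  rw [wedgeWord, wedgeMap_apply_of_eq hk c _ h]
  simp

theorem wedgeWord_other (hk : 1 ≤ k) (c : K) {j : Fin n} (h : (j : ℕ) ≠ 0) (h' : (j : ℕ) ≠ k) :
    wedgeWord n hk c j = 0 := by
  rcases lt_or_gt_of_ne h' with h1 | h1
  · rw [wedgeWord, wedgeMap_apply_of_lt hk c _ h1, Pi.single_eq_of_ne]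
    simpa [Fin.ext_iff] using h
  · exact wedgeMap_apply_of_gt hk c _ h1

theorem injective_range_wedgeMap (hk : 1 ≤ k) (hkn : k < n) :
    Function.Injective fun c : K => LinearMap.range (wedgeMap n hk c) := by
  intro c d h
  have h1 : wedgeWord n hk c ∈ LinearMap.range (wedgeMap n hk d) := by
    rw [← show LinearMap.range (wedgeMap n hk c) = LinearMap.range (wedgeMap n hk d) from h]
    exact ⟨_, rfl⟩
  have h2 := apply_eq_of_mem_range_wedgeMap hk hkn d h1
  rwa [wedgeWord_self hk c rfl, wedgeWord_zero hk c rfl, mul_one] at h2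

theorem shift_pow_apply (v : Fin n → K) (i : ℕ) {j j' : Fin n}
    (h : (j' : ℕ) = (j + i) % n) : ((shift n K) ^ i) v j = v j' := by
  induction i generalizing j with
  | zero =>
    rw [add_zero, Nat.mod_eq_of_lt j.2] at h
    rw [Fin.ext h]
    rfl
  | succ i ih =>
    rw [pow_succ', Module.End.mul_apply]
    change ((shift n K) ^ i) v (finRotate n j) = _
    refine ih ?_
    obtain _ | n := n
    · exact j.elim0
    rw [finRotate_apply, Fin.val_add, Fin.val_one', h]
    rw [Nat.add_mod_mod, Nat.mod_add_mod]
    congr 1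
    omega

/-- Shifting `(1, 0, …, 0, c, 0, …, 0)` by `k` places brings `c` to position `0`, so a cyclic code
would need `c²` in position `k`. The entry there is the one at `2k mod n`, which is `1` or `0`. -/
theorem not_isCyclicCode_range_wedgeMap (hk : 1 ≤ k) (hkn : k < n) {c : K} (hc0 : c ≠ 0)
    (hc1 : c ^ 2 ≠ 1) : ¬ IsCyclicCode (LinearMap.range (wedgeMap n hk c)) := by
  intro h
  have hpow : ∀ i : ℕ, ((shift n K) ^ i) (wedgeWord n hk c) ∈
      LinearMap.range (wedgeMap n hk c) := by
    intro i
    induction i with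
    | zero => exact ⟨_, rfl⟩
    | succ i ih =>
      rw [pow_succ', Module.End.mul_apply]
      exact h.shift_mem ih
  have h1 := apply_eq_of_mem_range_wedgeMap hk hkn c (hpow k)
  have hpos : 0 < n := by omega
  rw [shift_pow_apply _ k (j := ⟨0, _⟩) (j' := ⟨k, hkn⟩)
      (by simp [Nat.mod_eq_of_lt hkn]),
    shift_pow_apply _ k (j := ⟨k, hkn⟩) (j' := ⟨(k + k) % n, Nat.mod_lt _ hpos⟩) rfl,
    wedgeWord_self hk c (j := ⟨k, hkn⟩) rfl] at h1
  by_cases h0 : (k + k) % n = 0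
  · rw [wedgeWord_zero hk c h0] at h1
    exact hc1 (by rw [pow_two, ← h1])
  · rw [wedgeWord_other hk c h0] at h1
    · exact mul_ne_zero hc0 hc0 h1.symm
    · change (k + k) % n ≠ k
      intro hkk
      rcases lt_or_ge (k + k) n with hlt | hge
      · rw [Nat.mod_eq_of_lt hlt] at hkk
        omega
      · rw [Nat.mod_eq_sub_mod hge, Nat.mod_eq_of_lt (by omega)] at hkk
        omega

theorem exists_finset_not_isCyclicCode [Infinite K] (hk : 1 ≤ k) (hkn : k < n) (M : ℕ) :
    ∃ S : Finset (Submodule K (Fin n → K)), S.card = M ∧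
      ∀ D ∈ S, Module.finrank K D = k ∧ ¬ IsCyclicCode D := by
  classical
  -- These are the excluded values, where `c = 0` or `c² = 1`; other values give distinct non-cyclic
  -- codes.
  have hfin : ({0, 1, -1} : Set K).Finite := Set.toFinite _
  obtain ⟨t, ht, hcard⟩ := hfin.infinite_compl.exists_subset_card_eq M
  refine ⟨t.image fun c => LinearMap.range (wedgeMap n hk c), ?_, ?_⟩
  · rw [Finset.card_image_of_injective _ (injective_range_wedgeMap hk hkn), hcard]
  · intro D hD
    obtain ⟨c, hc, rfl⟩ := Finset.mem_image.1 hD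
    have hc' : c ∉ ({0, 1, -1} : Set K) := ht hc
    simp only [Set.mem_insert_iff, Set.mem_singleton_iff, not_or] at hc'
    refine ⟨finrank_range_wedgeMap hk hkn c, not_isCyclicCode_range_wedgeMap hk hkn hc'.1 ?_⟩
    rw [ne_eq, sq_eq_one_iff]
    tauto

end NonCyclic

/-! ### Realization of codes as tangent codes -/

section Realization

variable {K : Type*} [Field K] {n : ℕ}

theorem IsTwistedTranslate.isSmoothVariety [IsAlgClosed K] {p : ℕ} [CharP K p]
    {D : Submodule K (Fin n → K)} {Y : Set (Fin n → K)} (h : IsTwistedTranslate p D Y) :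
    IsSmoothVariety Y := fun a ha => by
  rw [(h.tangentSpace_eq_and_localDimension_eq ha).1,
    (h.tangentSpace_eq_and_localDimension_eq ha).2]

theorem isSmoothVariety_biUnion [IsAlgClosed K] {p : ℕ} [CharP K p] {ι : Type*} (S : Finset ι)
    (D : ι → Submodule K (Fin n → K)) {Y : ι → Set (Fin n → K)}
    (hY : ∀ i ∈ S, IsTwistedTranslate p (D i) (Y i)) (hdisj : (S : Set ι).PairwiseDisjoint Y) :
    IsSmoothVariety (⋃ i ∈ S, Y i) := by
  intro a ha
  obtain ⟨i, hi, hai⟩ := Set.mem_iUnion₂.1 ha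
  rw [(tangentSpace_biUnion S D hY hdisj hi hai).1, (tangentSpace_biUnion S D hY hdisj hi hai).2]

theorem isCyclicCode_and_tangentCodeIs {F : Subfield K} {X : Set (Fin n → K)}
    (hX : DefinedOver F X) {a : Fin n → K} (ha : a ∈ X) {g : Polynomial K}
    (hg : g ∈ generators n K) (h : tangentSpace K X a = generatedCode n K g) :
    IsCyclicCode (tangentCode F X a) ∧ TangentCodeIs F X a g :=
  ⟨(isCyclicCode_tangentCode_iff hX ha).2 (h ▸ isCyclicCode_generatedCode hg),
    tangentCodeIs_of_eq hX ha hg h⟩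

theorem exists_smooth_varieties_with_cyclic_tangentCodes (p : ℕ) [Fact p.Prime]
    [Algebra (ZMod p) K] [Algebra.IsAlgebraic (ZMod p) K] [IsAlgClosed K] [CharP K p]
    (hn : n ≠ 0) :
    ∃ (F : Subfield K) (Y : Polynomial K → Set (Fin n → K)), Finite F ∧
      (∀ g ∈ generators n K, IsAffineVariety (Y g) ∧ DefinedOver F (Y g) ∧
        IsSmoothVariety (Y g) ∧ (Y g).Nonempty ∧
        ∀ a ∈ Y g, IsCyclicCode (tangentCode F (Y g) a) ∧ TangentCodeIs F (Y g) a g) ∧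
      (generators n K \ {1}).PairwiseDisjoint Y ∧
      ∃ X : Set (Fin n → K), X = ⋃ g ∈ generators n K \ {1}, Y g ∧
        IsAffineVariety X ∧ DefinedOver F X ∧ IsSmoothVariety X ∧
        (∀ a ∈ X, IsCyclicCode (tangentCode F X a)) ∧
        ∀ k : ℕ, k < n → RealizesCyclicCodes F X k := by
  classical
  have hfin := finite_generators (K := K) hn
  let S := (hfin.sdiff (t := {1})).toFinset
  have hS : ∀ {g}, g ∈ S ↔ g ∈ generators n K ∧ g ≠ 1 := by simp [S]
  have hScoe : (S : Set (Polynomial K)) = generators n K \ {1} := Set.Finite.coe_toFinset _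
  obtain ⟨Y₀, hY₀, hdisj₀, -⟩ := exists_pairwiseDisjoint_isTwistedTranslate
    (Fact.out : p.Prime).ne_zero S (fun g => generatedCode n K g)
    fun g hg => generatedCode_lt_top (hS.1 hg).1 hn (hS.1 hg).2
  -- The code of `g = 1` is the whole space and is realized by the affine space itself, outside the
  -- disjoint union.
  let Y := Function.update Y₀ 1 Set.univ
  have hYY₀ : ∀ g ∈ S, Y g = Y₀ g := fun g hg => Function.update_of_ne (hS.1 hg).2 _ _
  have hYS : ∀ g ∈ S, IsTwistedTranslate p (generatedCode n K g) (Y g) := by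
    intro g hg
    rw [hYY₀ g hg]
    exact hY₀ g hg
  have hdisj : (S : Set (Polynomial K)).PairwiseDisjoint Y := by
    intro g hg h hh hgh
    rw [Function.onFun, hYY₀ g hg, hYY₀ h hh]
    exact hdisj₀ hg hh hgh
  have hY : ∀ g ∈ generators n K, IsTwistedTranslate p (generatedCode n K g) (Y g) := by
    intro g hg
    by_cases h1 : g = 1
    · subst h1
      rw [show Y 1 = Set.univ from Function.update_self _ _ _]
      refine isTwistedTranslate_univ p _ (Submodule.eq_top_of_finrank_eq ?_)
      simpa using finrank_generatedCode hg hn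
    · exact hYS g (hS.2 ⟨hg, h1⟩)
  -- One finite field serves the union and all pieces, since each needs only finitely many
  -- coefficients.
  choose s hs hsF using fun Z : Set (Fin n → K) => exists_finite_forall_definedOver Z
  obtain ⟨F, hF, hsub⟩ := exists_finite_subfield (K := K) p
    ((hs (⋃ g ∈ S, Y g)).union (hfin.biUnion fun g _ => hs (Y g)))
  have hFY : ∀ g ∈ generators n K, DefinedOver F (Y g) := fun g hg =>
    hsF _ _ ((Set.subset_biUnion_of_mem (u := fun g => s (Y g)) hg).trans
      (Set.subset_union_right.trans hsub))
  have hFX : DefinedOver F (⋃ g ∈ S, Y g) := hsF _ _ (Set.subset_union_left.trans hsub)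
  refine ⟨F, Y, hF, fun g hg => ⟨(hY g hg).isAffineVariety, hFY g hg, (hY g hg).isSmoothVariety,
    ?_, fun a ha => isCyclicCode_and_tangentCodeIs (hFY g hg) ha hg
      ((hY g hg).tangentSpace_eq_and_localDimension_eq ha).1⟩, hScoe ▸ hdisj,
    ⋃ g ∈ S, Y g, ?_, isAffineVariety_biUnion S fun g hg => (hYS g hg).isAffineVariety, hFX,
    isSmoothVariety_biUnion S _ hYS hdisj, ?_, ?_⟩
  · obtain ⟨M, w, -, hne, -⟩ := hY g hg
    exact hne
  · rw [← hScoe]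
    rfl
  · intro a ha
    obtain ⟨g, hg, hag⟩ := Set.mem_iUnion₂.1 ha
    exact (isCyclicCode_and_tangentCodeIs hFX ha (hS.1 hg).1
      (tangentSpace_biUnion S _ hYS hdisj hg hag).1).1
  · intro k hk g hg hgk
    have hgS : g ∈ S := hS.2 ⟨hg, by
      rintro rfl
      rw [Polynomial.natDegree_one] at hgk
      omega⟩
    obtain ⟨M, w, -, ⟨a, ha⟩, -⟩ := hYS g hgS
    have haX : a ∈ ⋃ g ∈ S, Y g := Set.mem_biUnion hgS ha
    exact ⟨a, haX, tangentCodeIs_of_eq hFX haX hg (tangentSpace_biUnion S _ hYS hdisj hgS ha).1⟩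

theorem exists_variety_with_cyclic_and_nonCyclic_tangentCodes (p : ℕ) [Fact p.Prime]
    [Algebra (ZMod p) K] [Algebra.IsAlgebraic (ZMod p) K] [IsAlgClosed K] [CharP K p]
    {k : ℕ} (M : ℕ) (hk : 1 ≤ k) (hkn : k < n) :
    ∃ (F : Subfield K) (X : Set (Fin n → K)), Finite F ∧
      IsAffineVariety X ∧ DefinedOver F X ∧ dimension X = (k : WithBot ℕ∞) ∧
      RealizesCyclicCodes F X k ∧ (M : ℕ∞) ≤ (nonCyclicTangentCodes F X).encard := by
  classical
  have hn : n ≠ 0 := by omega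
  have hfin : {g ∈ generators n K | g.natDegree + k = n}.Finite :=
    (finite_generators (K := K) hn).subset fun g hg => hg.1
  -- Taking `M + 1` codes makes the family, hence the variety, visibly non-empty even for `M = 0`.
  obtain ⟨T, hTcard, hT⟩ := exists_finset_not_isCyclicCode (K := K) hk hkn (M + 1)
  let S : Finset (Submodule K (Fin n → K)) := hfin.toFinset.image (generatedCode n K) ∪ T
  have hSrank : ∀ D ∈ S, Module.finrank K D = k := by
    intro D hD
    rcases Finset.mem_union.1 hD with hD | hD
    · obtain ⟨g, hg, rfl⟩ := Finset.mem_image.1 hD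
      rw [Set.Finite.mem_toFinset] at hg
      have := finrank_generatedCode hg.1 hn
      have := hg.2
      omega
    · exact (hT D hD).1
  obtain ⟨Y, hY, hdisj, -⟩ := exists_pairwiseDisjoint_isTwistedTranslate
    (Fact.out : p.Prime).ne_zero S (fun D => D) fun D hD => lt_top_iff_ne_top.2 fun h => by
      have := hSrank D hD
      rw [h, finrank_top, Module.finrank_fin_fun] at this
      omega
  have hpt : ∀ D ∈ S, ∃ a ∈ ⋃ D ∈ S, Y D, tangentSpace K (⋃ D ∈ S, Y D) a = D := by
    intro D hD
    obtain ⟨M, w, -, ⟨a, ha⟩, -⟩ := hY D hD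
    exact ⟨a, Set.mem_biUnion hD ha, (tangentSpace_biUnion S _ hY hdisj hD ha).1⟩
  obtain ⟨s, hs, hsF⟩ := exists_finite_forall_definedOver (⋃ D ∈ S, Y D)
  obtain ⟨F, hF, hsub⟩ := exists_finite_subfield (K := K) p hs
  have hFX := hsF F hsub
  have haff : IsAffineVariety (⋃ D ∈ S, Y D) :=
    isAffineVariety_biUnion S fun D hD => (hY D hD).isAffineVariety
  refine ⟨F, ⋃ D ∈ S, Y D, hF, haff, hFX, dimension_eq haff ?_ ?_, ?_, ?_⟩
  · obtain ⟨D, hD⟩ : T.Nonempty := Finset.card_pos.1 (by omega)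
    obtain ⟨a, ha, -⟩ := hpt D (Finset.mem_union_right _ hD)
    exact ⟨a, ha⟩
  · intro a ha
    obtain ⟨D, hD, haD⟩ := Set.mem_iUnion₂.1 ha
    rw [(tangentSpace_biUnion S _ hY hdisj hD haD).2, hSrank D hD]
  · intro g hg hgk
    obtain ⟨a, ha, hTa⟩ := hpt (generatedCode n K g) (Finset.mem_union_left _
      (Finset.mem_image_of_mem _ ((Set.Finite.mem_toFinset _).2 ⟨hg, hgk⟩)))
    exact ⟨a, ha, tangentCodeIs_of_eq hFX ha hg hTa⟩
  · have hsubT : (T : Set (Submodule K (Fin n → K))) ⊆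
        nonCyclicTangentCodes F (⋃ D ∈ S, Y D) := by
      intro D hD
      obtain ⟨a, ha, hTa⟩ := hpt D (Finset.mem_union_right _ hD)
      refine ⟨a, ha, ?_, ?_⟩
      · rw [isCyclicCode_tangentCode_iff hFX ha, hTa]
        exact (hT D hD).2
      · rw [extendCode_tangentCode hFX ha, hTa]
    refine le_trans ?_ (Set.encard_le_encard hsubT)
    rw [Set.encard_coe_eq_coe_finsetCard, hTcard]
    exact_mod_cast Nat.le_succ M

end Realization

end TangentCodes

end

theorem corollary5p3 (p : ℕ) [Fact p.Prime] (K : Type*) [Field K] [Algebra (ZMod p) K]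
    [IsAlgClosure (ZMod p) K] :
    -- (i)
    (∀ (n k m : ℕ) (F : Subfield K) (X : Set (Fin n → K)) (f : Fin m → MvPolynomial (Fin n) F),
      Finite F → TangentCodes.IsAffineVariety X → TangentCodes.IsIrreducibleVariety X →
      TangentCodes.GenerateIdeal F X f → TangentCodes.dimension X = (k : WithBot ℕ∞) →
      ∃ Z : Set (Fin n → K), TangentCodes.IsAffineVariety Z ∧ Z ⊆ X ∧
        TangentCodes.cyclicLocus F X ∩ TangentCodes.smoothLocus F X f k =
          Z ∩ TangentCodes.smoothLocus F X f k) ∧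
    -- (ii)
    (∀ n : ℕ, Nat.Coprime p n →
      ∃ (F : Subfield K) (Y : Polynomial K → Set (Fin n → K)), Finite F ∧
        -- the pieces of the coproduct over all generator polynomials
        (∀ g ∈ TangentCodes.generators n K,
          TangentCodes.IsAffineVariety (Y g) ∧ TangentCodes.DefinedOver F (Y g) ∧
          TangentCodes.IsSmoothVariety (Y g) ∧ (Y g).Nonempty ∧
          ∀ a ∈ Y g, TangentCodes.IsCyclicCode (TangentCodes.tangentCode F (Y g) a) ∧
            TangentCodes.TangentCodeIs F (Y g) a g) ∧
        -- the disjoint union inside the affine space, over the generator polynomials other than 1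
        (TangentCodes.generators n K \ {1}).PairwiseDisjoint Y ∧
        ∃ X : Set (Fin n → K), X = ⋃ g ∈ TangentCodes.generators n K \ {1}, Y g ∧
          TangentCodes.IsAffineVariety X ∧ TangentCodes.DefinedOver F X ∧
          TangentCodes.IsSmoothVariety X ∧
          (∀ a ∈ X, TangentCodes.IsCyclicCode (TangentCodes.tangentCode F X a)) ∧
          ∀ k : ℕ, k < n → TangentCodes.RealizesCyclicCodes F X k) ∧
    -- (iii)
    (∀ n k M : ℕ, 1 ≤ k → k < n → Nat.Coprime p n →
      ∃ (F : Subfield K) (X : Set (Fin n → K)), Finite F ∧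
        TangentCodes.IsAffineVariety X ∧ TangentCodes.DefinedOver F X ∧
        TangentCodes.dimension X = (k : WithBot ℕ∞) ∧
        TangentCodes.RealizesCyclicCodes F X k ∧
        (M : ℕ∞) ≤ (TangentCodes.nonCyclicTangentCodes F X).encard) := by
  have : IsAlgClosed K := IsAlgClosure.isAlgClosed (ZMod p)
  have : Algebra.IsAlgebraic (ZMod p) K := IsAlgClosure.isAlgebraic
  have : CharP K p := charP_of_injective_algebraMap (algebraMap (ZMod p) K).injective p
  refine ⟨fun n k m F X f _ hX _ hf _ =>
    TangentCodes.exists_cyclicLocus_inter_smoothLocus_eq hX hf k, fun n hpn => ?_,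
    fun n k M hk hkn _ =>
      TangentCodes.exists_variety_with_cyclic_and_nonCyclic_tangentCodes p M hk hkn⟩
  refine TangentCodes.exists_smooth_varieties_with_cyclic_tangentCodes p ?_
  rintro rfl
  -- Coprimality excludes `n = 0`, because the greatest common divisor of `p` and `0` is `p`.
  exact (Fact.out : p.Prime).ne_one (Nat.coprime_zero_right p |>.1 hpn)
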